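/- Let $m\ge 1$ be an integer and let $x$ be a complex random variable with $\mathbb E x=0$, $\mathbb E|x|^2=1$ and $\mathbb E|x|^4<\infty$. For every $N\ge 1$ let $x_{ij}=x_{ij}^{(N)}$, $1\le i,j\le N$, be independent copies of $x$ (for different $N$ these arrays may be related in any way; for instance, they may all be cut out of one infinite array). Put $\mathbf X=(N^{-1/2}x_{ij})_{1\le i,j\le N}$, let $\lambda_1,\dots,\lambda_N$ be the eigenvalues, with multiplicity, of $\mathbf X^m(\mathbf X^*)^m$ (the squared singular values of $\mathbf X^m$), and let $$F_N^{(m)}(t)=\frac1N\sum_{k=1}^N \mathbb I\{\lambda_k\le t\},\qquad t\in\mathbb R .$$ There is exactly one probability measure on $\mathbb R$ all of whose moments are finite and given by the Fuss--Catalan numbers $$\int_{\mathbb R} s^p\,dG^{(m)}(s)=\frac1{mp+1}\binom{mp+p}{p},\qquad p=0,1,2,\dots;$$ let $G^{(m)}$ denote this measure and also its distribution function. Then for every $t\in\mathbb R$ the limit $\lim_{N\to\infty}\mathbb E F_N^{(m)}(t)$ exists and equals $G^{(m)}(t)$. -/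

import Mathlib

open MeasureTheory ProbabilityTheory Filter Topology
open scoped Matrix

noncomputable section

/-- The random matrix with entries `N^{-1/2} x_{ij}`, at one sample point. -/
def scaledMatrix {N : ℕ} (x : Fin N → Fin N → ℂ) : Matrix (Fin N) (Fin N) ℂ :=
  Matrix.of fun i j => ((Real.sqrt N : ℝ) : ℂ)⁻¹ * x i j

/-- The matrix `W = X^m (X^*)^m`. -/
def powerGram {N : ℕ} (m : ℕ) (X : Matrix (Fin N) (Fin N) ℂ) : Matrix (Fin N) (Fin N) ℂ :=
  X ^ m * Xᴴ ^ m

theorem powerGram_isHermitian {N : ℕ} (m : ℕ) (X : Matrix (Fin N) (Fin N) ℂ) :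
    (powerGram m X).IsHermitian := by
  unfold powerGram
  rw [← Matrix.conjTranspose_pow]
  exact Matrix.isHermitian_mul_conjTranspose_self _

/-- The empirical distribution function `N⁻¹ ∑ k, 𝟙{λ_k ≤ t}`, where `λ_1, …, λ_N` are the
eigenvalues, with multiplicity, of `X^m (X^*)^m`, that is, the squared singular values of `X^m`. -/
def empiricalDF {N : ℕ} (m : ℕ) (X : Matrix (Fin N) (Fin N) ℂ) (t : ℝ) : ℝ :=
  (N : ℝ)⁻¹ * ∑ k : Fin N,
    Set.indicator (Set.Iic t) (fun _ => (1 : ℝ)) ((powerGram_isHermitian m X).eigenvalues k)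

/-- `μ` is a probability measure on the line all of whose moments exist, the `p`-th one being the
Fuss–Catalan number `binom (mp + p) p / (mp + 1)`. -/
structure IsFussCatalanLaw (m : ℕ) (μ : Measure ℝ) : Prop where
  isProbabilityMeasure : IsProbabilityMeasure μ
  integrable_pow : ∀ p : ℕ, Integrable (fun s : ℝ => s ^ p) μ
  moment_eq : ∀ p : ℕ,
    ∫ s : ℝ, s ^ p ∂μ = 1 / ((m : ℝ) * (p : ℝ) + 1) * ((m * p + p).choose p : ℝ)

end

/-!
Truncating the entries at a level `o(√N)` changes the matrix only with probability `o(1)`, by the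
fourth moment, so the entries may be assumed to be bounded by `o(√N)`. The normalized expected trace
of `(X^m (X^*)^m)^p` is then a sum over closed walks. As the entries are centered with variance
`1/N`, in the limit only those walks contribute that traverse every edge once in each direction and
reach a new vertex along each new edge, that is, walks which can be followed with a stack. They are
counted by the noncrossing pairings of the word `(X^m (X^*)^m)^p`, whose generating function solves
`C = 1 + z C^(m+1)`, and this gives the Fuss–Catalan numbers.

These numbers are also the moments of a constant times a product of `m` independent beta variables,
a law with bounded support and without atoms. Hence the indicators of half-lines can be sandwiched
between polynomials with almost the same integral, which proves that this law is unique and turns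
the convergence of moments into that of distribution functions.
-/

open Finset.HasAntidiagonal (antidiagonal mem_antidiagonal)

/-- The number of ways in which a stack automaton can read the word `w` in two mutually inverse
letters and empty the stack `s`, where reading a letter either pushes the opposite letter or pops
the same letter. Its value at `w` and the empty stack is the number of noncrossing pairings of
opposite letters of `w`. -/
def stackCount : List Bool → List Bool → ℕ
  | [], [] => 1
  | [], _ :: _ => 0
  | a :: w, [] => stackCount w [!a]
  | a :: w, b :: s => stackCount w ((!a) :: b :: s) + if a = b then stackCount w s else 0

theorem stackCount_append_singleton (w s : List Bool) (a : Bool) :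
    stackCount (w ++ [a]) s =
      stackCount w (s ++ [!a]) + if s.getLast? = some a then stackCount w s.dropLast else 0 := by
  induction w generalizing s with
  | nil => rcases s with _ | ⟨c, _ | ⟨d, s⟩⟩ <;> simp [stackCount, eq_comm]
  | cons x w ih =>
    rcases s with _ | ⟨c, _ | ⟨d, s⟩⟩
    · have : (!x) = a ↔ x = !a := by cases x <;> cases a <;> simp
      simp [stackCount, ih, this]
    · simp [stackCount, ih, add_right_comm, eq_comm]
    · simp only [List.cons_append, stackCount, ih, List.getLast?_cons_cons, List.dropLast_cons_cons]
      split_ifs <;> ring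

theorem stackCount_append_singleton_nil (a : Bool) (w : List Bool) :
    stackCount (w ++ [a]) [] = stackCount (a :: w) [] := by
  simp [stackCount_append_singleton, stackCount]

/-- The factor of length `n`, starting at position `i`, of the infinite word `l`. -/
def window (l : ℕ → Bool) (i n : ℕ) : List Bool :=
  (List.range' i n).map l

@[simp]
theorem window_zero (l : ℕ → Bool) (i : ℕ) : window l i 0 = [] := rfl

theorem window_succ (l : ℕ → Bool) (i n : ℕ) : window l i (n + 1) = l i :: window l (i + 1) n := rfl

theorem window_add (l : ℕ → Bool) (i n k : ℕ) :
    window l i (n + k) = window l i n ++ window l (i + n) k := by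
  simp only [window, ← List.map_append, List.range'_append_1]

theorem window_add_period {l : ℕ → Bool} {k : ℕ} (hl : l.Periodic k) (i n : ℕ) :
    window l (i + k) n = window l i n := by
  induction n generalizing i with
  | zero => rfl
  | succ n ih => rw [window_succ, window_succ, hl, add_right_comm, ih]

theorem stackCount_window_of_periodic {l : ℕ → Bool} {n : ℕ} (hl : l.Periodic n) (i : ℕ) :
    stackCount (window l i n) [] = stackCount (window l 0 n) [] := by
  induction i with
  | zero => rfl
  | succ i ih =>
    rw [← ih]
    cases n with
    | zero => rfl
    | succ n =>
      have h_last : window l (i + 1 + n) 1 = [l i] := by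
        rw [← hl i, add_right_comm, add_assoc]
        rfl
      rw [window_add, h_last, stackCount_append_singleton_nil, window_succ]

/-- A letter `b` of the initial stack is popped at some position of the word; the letters read
before it deal with the part of the stack above `b`, and those read after it with the part below. -/
theorem stackCount_window_succ_append (l : ℕ → Bool) (b : Bool) (s t : List Bool) (n i : ℕ) :
    stackCount (window l i (n + 1)) (s ++ b :: t) =
      ∑ p ∈ antidiagonal n, if l (i + p.1) = b then
        stackCount (window l i p.1) s * stackCount (window l (i + p.1 + 1) p.2) t else 0 := by
  induction n generalizing i s with
  | zero => rcases s with _ | ⟨a, _ | ⟨c, s⟩⟩ <;> simp [window, stackCount]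
  | succ n ih =>
    have h_shift (k : ℕ) : i + 1 + k = i + (k + 1) := by omega
    rw [Finset.Nat.sum_antidiagonal_succ, window_succ]
    cases s with
    | nil =>
      have h_push := ih [!l i] (i + 1)
      simp only [h_shift, List.singleton_append] at h_push
      simp only [List.nil_append, stackCount, h_push, window_succ l i, window_zero, add_zero,
        one_mul, add_comm]
    | cons a s =>
      have h_push := ih ((!l i) :: a :: s) (i + 1)
      have h_pop := ih s (i + 1)
      simp only [List.cons_append, h_shift] at h_push h_pop ⊢
      simp only [stackCount, h_push, h_pop, window_succ l i, window_zero, zero_mul, ite_self,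
        zero_add]
      by_cases h_top : l i = a
      · simp only [if_pos h_top, ← Finset.sum_add_distrib]
        refine Finset.sum_congr rfl fun p _ => ?_
        split_ifs <;> ring
      · simp only [if_neg h_top, add_zero]

theorem stackCount_window_add_two (l : ℕ → Bool) (n i : ℕ) :
    stackCount (window l i (n + 2)) [] =
      ∑ p ∈ antidiagonal n, if l (i + 1 + p.1) = !l i then
        stackCount (window l (i + 1) p.1) [] * stackCount (window l (i + 1 + p.1 + 1) p.2) []
      else 0 :=
  stackCount_window_succ_append l (!l i) [] [] n (i + 1)

/-- The number of letters `true` minus the number of letters `false` of a word. -/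
def wordHeight (w : List Bool) : ℤ :=
  w.count true - w.count false

theorem wordHeight_cons (a : Bool) (w : List Bool) :
    wordHeight (a :: w) = wordHeight w + if a then 1 else -1 := by
  cases a <;> simp [wordHeight] <;> ring

theorem wordHeight_eq_of_stackCount_ne_zero {w s : List Bool} (h : stackCount w s ≠ 0) :
    wordHeight w = wordHeight s := by
  induction w generalizing s with
  | nil =>
    cases s with
    | nil => rfl
    | cons b s => exact absurd rfl h
  | cons a w ih =>
    have h_push (s : List Bool) (hw : stackCount w ((!a) :: s) ≠ 0) :
        wordHeight (a :: w) = wordHeight s := by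
      rw [wordHeight_cons, ih hw, wordHeight_cons]
      cases a <;> simp
    cases s with
    | nil => exact h_push [] h
    | cons b s =>
      by_cases hw : stackCount w ((!a) :: b :: s) = 0
      · rw [stackCount, hw, zero_add, ite_ne_right_iff] at h
        rw [wordHeight_cons, wordHeight_cons, ih h.2, h.1]
      · exact h_push (b :: s) hw

/-- The letters of the word `X^m (X^*)^m X^m (X^*)^m ⋯`, with `true` standing for `X`. -/
def zigzag (m i : ℕ) : Bool := decide (i % (2 * m) < m)

theorem zigzag_periodic (m : ℕ) : (zigzag m).Periodic (2 * m) := fun i => by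
  simp only [zigzag, Nat.add_mod_right]

theorem stackCount_window_zigzag (m b i : ℕ) :
    stackCount (window (zigzag m) i (2 * m * b)) [] =
      stackCount (window (zigzag m) 0 (2 * m * b)) [] :=
  stackCount_window_of_periodic (by simpa [mul_comm] using (zigzag_periodic m).nat_mul b) i

/-- The height at `i` of the path which goes up at the letters `true` of `zigzag m` and down at
its letters `false`. -/
def zigzagHeight (m i : ℕ) : ℤ :=
  if i % (2 * m) < m then ((i % (2 * m) : ℕ) : ℤ) else 2 * m - ((i % (2 * m) : ℕ) : ℤ)

theorem zigzagHeight_succ {m : ℕ} (hm : 0 < m) (i : ℕ) :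
    zigzagHeight m (i + 1) = zigzagHeight m i + if zigzag m i then 1 else -1 := by
  have h_lt : i % (2 * m) < 2 * m := Nat.mod_lt i (by omega)
  have h_mod : (i + 1) % (2 * m) = if i % (2 * m) + 1 = 2 * m then 0 else i % (2 * m) + 1 := by
    rw [Nat.add_mod_eq_ite, Nat.mod_eq_of_lt (show 1 < 2 * m by omega)]
    split_ifs <;> omega
  simp only [zigzagHeight, zigzag, decide_eq_true_eq, h_mod]
  split_ifs <;> omega

theorem wordHeight_window_zigzag {m : ℕ} (hm : 0 < m) (n i : ℕ) :
    wordHeight (window (zigzag m) i n) = zigzagHeight m (i + n) - zigzagHeight m i := by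
  induction n generalizing i with
  | zero => simp [wordHeight]
  | succ n ih =>
    rw [window_succ, wordHeight_cons, ih, zigzagHeight_succ hm, add_right_comm, add_assoc i]
    ring

theorem zigzag_up {m k d : ℕ} (h : k + d + 1 = m) : zigzag m k = true := by
  rw [zigzag, Nat.mod_eq_of_lt (by omega), decide_eq_true_iff]
  omega

theorem zigzag_return {m k d : ℕ} (h : k + d + 1 = m) (j : ℕ) :
    zigzag m (k + 1 + (2 * d + 2 * m * j)) = false := by
  have h_pos : k + 1 + (2 * d + 2 * m * j) = k + 1 + 2 * d + 2 * m * j := by ring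
  rw [zigzag, h_pos, Nat.add_mul_mod_self_left, Nat.mod_eq_of_lt (by omega),
    decide_eq_false_iff_not]
  omega

theorem exists_eq_of_stackCount_zigzag_ne_zero {m k d n : ℕ} (h : k + d + 1 = m)
    (h_count : stackCount (window (zigzag m) (k + 1) n) [] ≠ 0)
    (h_down : zigzag m (k + 1 + n) = false) :
    ∃ j, n = 2 * d + 2 * m * j := by
  have h_height := wordHeight_eq_of_stackCount_ne_zero h_count
  rw [wordHeight_window_zigzag (by omega)] at h_height
  have h_start : (k + 1) % (2 * m) = k + 1 := Nat.mod_eq_of_lt (by omega)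
  have h_end : ¬(k + 1 + n) % (2 * m) < m := by simpa [zigzag] using h_down
  have h_div := Nat.div_add_mod (k + 1 + n) (2 * m)
  simp only [zigzagHeight, if_neg h_end, h_start, wordHeight, List.count_nil] at h_height
  refine ⟨(k + 1 + n) / (2 * m), ?_⟩
  split_ifs at h_height <;> omega

theorem stackCount_zigzag_succ {m k d : ℕ} (h : k + d + 1 = m) (b : ℕ) :
    stackCount (window (zigzag m) k (2 * (d + 1) + 2 * m * b)) [] =
      ∑ q ∈ antidiagonal b, stackCount (window (zigzag m) (k + 1) (2 * d + 2 * m * q.1)) [] *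
        stackCount (window (zigzag m) 0 (2 * m * q.2)) [] := by
  have h_len : 2 * (d + 1) + 2 * m * b = 2 * d + 2 * m * b + 2 := by ring
  rw [h_len, stackCount_window_add_two, zigzag_up h, Bool.not_true]
  symm
  refine Finset.sum_of_injOn (fun q => (2 * d + 2 * m * q.1, 2 * m * q.2)) ?_ ?_ ?_ ?_
  · rintro ⟨j₁, j₂⟩ - ⟨k₁, k₂⟩ - h_eq
    have hm : m ≠ 0 := by omega
    simpa [hm] using h_eq
  · rintro ⟨j₁, j₂⟩ hj
    simp only [Finset.mem_coe, mem_antidiagonal] at hj ⊢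
    rw [← hj]
    ring
  · rintro ⟨n₁, n₂⟩ hn h_not_mem
    by_contra h_ne
    rw [ite_eq_right_iff, Classical.not_imp, mul_eq_zero, not_or] at h_ne
    obtain ⟨j, rfl⟩ := exists_eq_of_stackCount_zigzag_ne_zero h h_ne.2.1 h_ne.1
    have h_sum : 2 * d + 2 * m * j + n₂ = 2 * d + 2 * m * b := mem_antidiagonal.1 hn
    obtain ⟨e, rfl⟩ := Nat.exists_eq_add_of_le (Nat.le_of_mul_le_mul_left
      (show 2 * m * j ≤ 2 * m * b by omega) (by omega))
    refine h_not_mem ⟨(j, e), mem_antidiagonal.2 rfl, Prod.ext rfl ?_⟩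
    rw [mul_add] at h_sum
    change 2 * m * e = n₂
    omega
  · rintro ⟨j₁, j₂⟩ -
    rw [if_pos (zigzag_return h j₁),
      stackCount_window_zigzag m j₂ (k + 1 + (2 * d + 2 * m * j₁) + 1)]

/-- The generating function in `b` of the numbers of noncrossing pairings of the words
`X^d ((X^*)^m X^m)^b (X^*)^d`, the factors of `zigzag m` between two visits of the height
`m - d`. -/
def zigzagSeries (K : Type*) [Semiring K] (m d : ℕ) : PowerSeries K :=
  PowerSeries.mk fun b => (stackCount (window (zigzag m) (m - d) (2 * d + 2 * m * b)) [] : K)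

theorem zigzagSeries_succ (K : Type*) [CommSemiring K] {m d : ℕ} (hd : d < m) :
    zigzagSeries K m (d + 1) = zigzagSeries K m d * zigzagSeries K m 0 := by
  have h_start : m - d = m - (d + 1) + 1 := by omega
  ext b
  simp only [PowerSeries.coeff_mul, zigzagSeries, PowerSeries.coeff_mk, h_start]
  rw [stackCount_zigzag_succ (show m - (d + 1) + d + 1 = m by omega)]
  simp only [Nat.cast_sum, Nat.cast_mul, mul_zero, zero_add, Nat.sub_zero,
    stackCount_window_zigzag m _ m]

theorem zigzagSeries_eq_pow (K : Type*) [CommSemiring K] {m d : ℕ} (hd : d ≤ m) :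
    zigzagSeries K m d = zigzagSeries K m 0 ^ (d + 1) := by
  induction d with
  | zero => simp
  | succ d ih => rw [zigzagSeries_succ K hd, ih (by omega), ← pow_succ]

theorem zigzagSeries_zero_eq (K : Type*) [CommSemiring K] (m : ℕ) :
    zigzagSeries K m 0 = 1 + PowerSeries.X * zigzagSeries K m 0 ^ (m + 1) := by
  rw [← zigzagSeries_eq_pow K le_rfl]
  ext b
  cases b with
  | zero => simp [zigzagSeries, stackCount]
  | succ b =>
    have h_shift := stackCount_window_zigzag m (b + 1) m
    rw [mul_add_one, add_comm] at h_shift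
    rw [map_add, PowerSeries.coeff_succ_X_mul]
    simp [zigzagSeries, PowerSeries.coeff_one, h_shift, mul_add_one, add_comm (2 * m * b)]

section FussCatalan

variable {K : Type*} [Field K] [CharZero K]

theorem choose_add_one_mul_sub (M p : ℕ) :
    (M.choose (p + 1) : K) * (p + 1) = M.choose p * (M - p) := by
  rcases le_or_gt p M with h | h
  · rw [← Nat.cast_sub h]
    exact_mod_cast Nat.choose_succ_right_eq M p
  · simp [Nat.choose_eq_zero_of_lt h, Nat.choose_eq_zero_of_lt (h.trans p.lt_succ_self)]

/-- Raney's formula for the coefficients of the powers of the solution of `C = 1 + X C^(n+1)`,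
by the recursion `C^(r+1) = C^r + X C^(r+n+1)`. -/
theorem coeff_pow_of_eq_one_add_X_mul_pow {n : ℕ} {C : PowerSeries K}
    (hC : C = 1 + PowerSeries.X * C ^ (n + 1)) (p r : ℕ) :
    ((n + 1) * p + r : K) * PowerSeries.coeff p (C ^ r) = r * ((n + 1) * p + r).choose p := by
  induction p generalizing r with
  | zero =>
    have hC0 : PowerSeries.constantCoeff C = 1 := by rw [hC]; simp
    simp [hC0]
  | succ p ihp =>
    induction r with
    | zero => simp
    | succ r ihr =>
      have h_pow : C ^ (r + 1) = C ^ r + PowerSeries.X * C ^ (r + (n + 1)) := by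
        calc C ^ (r + 1) = C ^ r * (1 + PowerSeries.X * C ^ (n + 1)) := by rw [← hC, pow_succ]
          _ = _ := by ring
      have h_coeff := ihp (r + (n + 1))
      rw [h_pow, map_add, PowerSeries.coeff_succ_X_mul]
      set u := PowerSeries.coeff (p + 1) (C ^ r)
      set v := PowerSeries.coeff p (C ^ (r + (n + 1)))
      have hM : (n + 1) * p + (r + (n + 1)) = (n + 1) * (p + 1) + r := by ring
      have hM₀ : ((n + 1) * (p + 1) + r : K) ≠ 0 := by exact_mod_cast (by positivity)
      rw [hM] at h_coeff
      rw [← add_assoc ((n + 1) * (p + 1)), Nat.choose_succ_succ]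
      have h_choose := choose_add_one_mul_sub (K := K) ((n + 1) * (p + 1) + r) p
      push_cast at *
      set x : K := (((n + 1) * (p + 1) + r).choose p : K)
      set y : K := (((n + 1) * (p + 1) + r).choose (p + 1) : K)
      apply mul_left_cancel₀ hM₀
      linear_combination ((n + 1) * (p + 1) + r + 1 : K) * (ihr + h_coeff) - (n + 1 : K) * h_choose

end FussCatalan

/-- The Fuss–Catalan numbers, as real numbers. -/
noncomputable def fussCatalan (m p : ℕ) : ℝ :=
  1 / ((m : ℝ) * (p : ℝ) + 1) * ((m * p + p).choose p : ℝ)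

theorem coeff_eq_fussCatalan {m : ℕ} {C : PowerSeries ℝ}
    (hC : C = 1 + PowerSeries.X * C ^ (m + 1)) (p : ℕ) :
    PowerSeries.coeff p C = fussCatalan m p := by
  have h_raney := coeff_pow_of_eq_one_add_X_mul_pow hC p 1
  have h_choose : ((m * p + p).choose p : ℝ) * (m * p + p + 1) =
      (m * p + p + 1).choose p * (m * p + 1) := by
    have h_sub : m * p + p + 1 - p = m * p + 1 := by omega
    exact_mod_cast h_sub ▸ Nat.choose_mul_succ_eq (m * p + p) p
  rw [pow_one, Nat.cast_one, one_mul, show (m + 1) * p + 1 = m * p + p + 1 by ring] at h_raney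
  have h₁ : (m * p + 1 : ℝ) ≠ 0 := by positivity
  have h₂ : (m * p + p + 1 : ℝ) ≠ 0 := by positivity
  rw [fussCatalan]
  field_simp
  apply mul_left_cancel₀ h₂
  linear_combination (m * p + 1 : ℝ) * h_raney - h_choose

theorem stackCount_zigzag (m p : ℕ) :
    (stackCount (window (zigzag m) 0 (2 * m * p)) [] : ℝ) = fussCatalan m p := by
  simpa [zigzagSeries, stackCount_window_zigzag m p m] using
    coeff_eq_fussCatalan (zigzagSeries_zero_eq ℝ m) p

section Walks

variable {V : Type*}

/-- The position of the entry of a matrix `A` which a step from `u` to `v` contributes to a product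
of matrices, if the factor of this step is `A` (for `true`) or `Aᴴ` (for `false`). -/
def stepEntry (a : Bool) (u v : V) : V × V := if a then (u, v) else (v, u)

theorem stepEntry_not (a : Bool) (u v : V) : stepEntry (!a) u v = stepEntry a v u := by
  cases a <;> rfl

theorem stepEntry_mem_product {S : Finset V} {a : Bool} {u v : V} :
    stepEntry a u v ∈ S ×ˢ S ↔ u ∈ S ∧ v ∈ S := by
  cases a <;> simp [stepEntry, and_comm]

theorem eq_of_stepEntry_eq {a b : Bool} {u v p : V} (h : stepEntry a v u = stepEntry b p v)
    (hvp : v ≠ p) : u = p ∧ b = !a := by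
  cases a <;> cases b <;> simp_all [stepEntry]

/-- The letters and the matrix entries of the walk which starts at a given vertex and continues
with the vertices of a list, one for each letter of a word. -/
def walkEntries : V → List Bool → List V → List (Bool × (V × V))
  | v, a :: w, u :: us => (a, stepEntry a v u) :: walkEntries u w us
  | _, [], _ => []
  | _, _ :: _, [] => []

/-- The matrix entries of a walk. -/
def walkEdges (v : V) (w : List Bool) (us : List V) : List (V × V) :=
  (walkEntries v w us).map Prod.snd

theorem walkEdges_cons (v u : V) (a : Bool) (w : List Bool) (us : List V) :
    walkEdges v (a :: w) (u :: us) = stepEntry a v u :: walkEdges u w us := rfl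

theorem length_walkEntries (v : V) (w : List Bool) (us : List V) (h : us.length = w.length) :
    (walkEntries v w us).length = w.length := by
  induction w generalizing v us with
  | nil => simp [walkEntries]
  | cons a w ih =>
    obtain ⟨u, us, rfl⟩ := List.exists_cons_of_length_eq_add_one h
    simp [walkEntries, ih u us (by simpa using h)]

/-- The last vertex of the walk which starts at a given vertex and continues with the vertices of a
list. -/
def walkEnd : V → List V → V
  | v, [] => v
  | _, u :: us => walkEnd u us

/-- The letters and entries of the path along a stack up to its top vertex `v`. An element `(p, a)`
of the stack is the vertex below on this path, with the letter of the step up from `p`. -/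
def stackEntries : V → List (V × Bool) → List (Bool × (V × V))
  | _, [] => []
  | v, (p, a) :: st => (a, stepEntry a p v) :: stackEntries p st

/-- The matrix entries of the path along a stack. -/
def stackEdges (v : V) (st : List (V × Bool)) : List (V × V) :=
  (stackEntries v st).map Prod.snd

theorem stackEdges_cons (v p : V) (a : Bool) (st : List (V × Bool)) :
    stackEdges v ((p, a) :: st) = stepEntry a p v :: stackEdges p st := rfl

theorem mem_product_of_mem_stackEdges {S : Finset V} {v : V} {st : List (V × Bool)}
    (hS : ∀ p ∈ v :: st.map Prod.fst, p ∈ S) {e : V × V} (he : e ∈ stackEdges v st) :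
    e ∈ S ×ˢ S := by
  induction st generalizing v with
  | nil => simp [stackEdges, stackEntries] at he
  | cons q st ih =>
    obtain ⟨p, a⟩ := q
    simp only [List.map_cons, List.forall_mem_cons] at hS
    rcases List.mem_cons.1 he with rfl | he
    · exact stepEntry_mem_product.2 ⟨hS.2.1, hS.1⟩
    · exact ih (List.forall_mem_cons.2 hS.2) he

theorem stepEntry_notMem_stackEdges {v p : V} {st : List (V × Bool)}
    (hv : v ∉ p :: st.map Prod.fst) (b : Bool) (u : V) : stepEntry b u v ∉ stackEdges p st := by
  classical
  intro h
  have h_mem := mem_product_of_mem_stackEdges (S := (p :: st.map Prod.fst).toFinset)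
    (fun _ => List.mem_toFinset.2) h
  exact hv (List.mem_toFinset.1 (stepEntry_mem_product.1 h_mem).2)

variable [DecidableEq V]

/-- Walks that, with `S` the set of vertices seen so far, at each step either go to a new vertex,
which is put on the stack, or back along the edge by which the current vertex was first reached, and
that end at the bottom of the stack. -/
inductive StackWalk : Finset V → V → List (V × Bool) → List Bool → List V → Prop
  | nil (S : Finset V) (v : V) : StackWalk S v [] [] []
  | push {S : Finset V} {v u : V} {st : List (V × Bool)} {a : Bool} {w : List Bool} {us : List V}
      (hu : u ∉ S) (h : StackWalk (insert u S) u ((v, a) :: st) w us) :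
      StackWalk S v st (a :: w) (u :: us)
  | pop {S : Finset V} {v p : V} {st : List (V × Bool)} {a : Bool} {w : List Bool} {us : List V}
      (h : StackWalk S p st w us) : StackWalk S v ((p, !a) :: st) (a :: w) (p :: us)

theorem stackWalk_cons_of_notMem {S : Finset V} {v u : V} {st : List (V × Bool)} {a : Bool}
    {w : List Bool} {us : List V} (hst : ∀ p ∈ st, p.1 ∈ S) (hu : u ∉ S) :
    StackWalk S v st (a :: w) (u :: us) ↔ StackWalk (insert u S) u ((v, a) :: st) w us := by
  refine ⟨fun h => ?_, StackWalk.push hu⟩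
  cases h with
  | push _ h => exact h
  | pop h => exact absurd (hst (u, !a) List.mem_cons_self) hu

theorem stackWalk_cons_of_mem {S : Finset V} {v u : V} {st : List (V × Bool)} {a : Bool}
    {w : List Bool} {us : List V} (hu : u ∈ S) :
    StackWalk S v st (a :: w) (u :: us) ↔
      ∃ st', st = (u, !a) :: st' ∧ StackWalk S u st' w us := by
  constructor
  · intro h
    cases h with
    | push hu' _ => exact absurd hu hu'
    | pop h => exact ⟨_, rfl, h⟩
  · rintro ⟨st', rfl, h⟩
    exact h.pop

theorem StackWalk.walkEnd_eq {S : Finset V} {v : V} {st : List (V × Bool)} {w : List Bool}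
    {us : List V} (h : StackWalk S v st w us) :
    walkEnd v us = walkEnd v (st.map Prod.fst) := by
  induction h with
  | nil => rfl
  | push _ _ ih => exact ih
  | pop _ ih => exact ih

/-- The number of vertices of a list outside of a finite set. -/
def newCard (S : Finset V) (us : List V) : ℕ := (us.toFinset \ S).card

theorem newCard_cons_of_mem {S : Finset V} {u : V} (hu : u ∈ S) (us : List V) :
    newCard S (u :: us) = newCard S us := by
  rw [newCard, newCard, List.toFinset_cons, Finset.insert_sdiff_of_mem _ hu]

theorem card_insert_sdiff_of_notMem {α : Type*} [DecidableEq α] {S T : Finset α} {u : α}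
    (hu : u ∉ S) : (insert u T \ S).card = (T \ insert u S).card + 1 := by
  rw [Finset.insert_sdiff_of_notMem _ hu, Finset.sdiff_insert, ← Finset.erase_insert_eq_erase,
    Finset.card_erase_add_one (Finset.mem_insert_self u _)]

theorem newCard_cons_of_notMem {S : Finset V} {u : V} (hu : u ∉ S) (us : List V) :
    newCard S (u :: us) = newCard (insert u S) us + 1 := by
  rw [newCard, newCard, List.toFinset_cons, card_insert_sdiff_of_notMem hu]

/-- A walk reaches each new vertex along a new edge. -/
theorem newCard_le_card_walkEdges {w : List Bool} {us : List V} (h_length : us.length = w.length)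
    {v : V} {S : Finset V} (hv : v ∈ S) :
    newCard S us ≤ ((walkEdges v w us).toFinset \ S ×ˢ S).card := by
  induction w generalizing us v S with
  | nil =>
    obtain rfl := List.length_eq_zero_iff.1 h_length
    simp [newCard]
  | cons a w ih =>
    obtain ⟨u, us, rfl⟩ := List.exists_cons_of_length_eq_add_one h_length
    have h_tail : us.length = w.length := by simpa using h_length
    rw [walkEdges_cons, List.toFinset_cons]
    by_cases hu : u ∈ S
    · rw [newCard_cons_of_mem hu]
      exact (ih h_tail hu).trans (Finset.card_le_card
        (Finset.sdiff_subset_sdiff (Finset.subset_insert _ _) le_rfl))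
    · rw [newCard_cons_of_notMem hu, card_insert_sdiff_of_notMem
        (fun h => hu (stepEntry_mem_product.1 h).2), Nat.add_le_add_iff_right]
      refine (ih h_tail (Finset.mem_insert_self u S)).trans
        (Finset.card_le_card (Finset.sdiff_subset_sdiff le_rfl (Finset.insert_subset ?_ ?_)))
      · exact stepEntry_mem_product.2 ⟨Finset.mem_insert_of_mem hv, Finset.mem_insert_self u S⟩
      · exact Finset.product_subset_product (Finset.subset_insert u S) (Finset.subset_insert u S)

theorem exists_eq_cons_of_card_le {w : List Bool} {us : List V} (h_length : us.length = w.length)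
    {S : Finset V} {v u : V} {a : Bool} {st : List (V × Bool)} (hu : u ∈ S)
    (hS : ∀ p ∈ v :: st.map Prod.fst, p ∈ S) (h_nodup : (v :: st.map Prod.fst).Nodup)
    (h_card : ((walkEdges v (a :: w) (u :: us)).toFinset \ (stackEdges v st).toFinset).card ≤
      newCard S (u :: us)) :
    ∃ st', st = (u, !a) :: st' := by
  have h_old : stepEntry a v u ∈ stackEdges v st := by
    by_contra h_new
    rw [walkEdges_cons, List.toFinset_cons, newCard_cons_of_mem hu,
      card_insert_sdiff_of_notMem (by simpa using h_new)] at h_card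
    have h_subset : insert (stepEntry a v u) (stackEdges v st).toFinset ⊆ S ×ˢ S :=
      Finset.insert_subset (stepEntry_mem_product.2 ⟨hS v List.mem_cons_self, hu⟩)
        fun e he => mem_product_of_mem_stackEdges hS (List.mem_toFinset.1 he)
    have h_le := (newCard_le_card_walkEdges h_length hu).trans
      (Finset.card_le_card (Finset.sdiff_subset_sdiff le_rfl h_subset))
    omega
  cases st with
  | nil => simp [stackEdges, stackEntries] at h_old
  | cons q st =>
    obtain ⟨p, b⟩ := q
    obtain ⟨hv, -⟩ := List.nodup_cons.1 h_nodup
    rcases List.mem_cons.1 h_old with h_top | h_below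
    · have hvp : v ≠ p := fun h => hv (by simp [h])
      obtain ⟨rfl, rfl⟩ := eq_of_stepEntry_eq h_top hvp
      exact ⟨st, rfl⟩
    · rw [← stepEntry_not] at h_below
      exact absurd h_below (stepEntry_notMem_stackEdges hv _ _)

theorem count_stackEdges_append_walkEdges_back (v u : V) (a : Bool) (st : List (V × Bool))
    (w : List Bool) (us : List V) (e : V × V) :
    (stackEdges v ((u, !a) :: st) ++ walkEdges v (a :: w) (u :: us)).count e =
      (stackEdges u st ++ walkEdges u w us).count e + 2 * [stepEntry a v u].count e := by
  rw [stackEdges_cons, walkEdges_cons, stepEntry_not]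
  simp only [List.cons_append, List.count_cons, List.count_append, List.count_nil]
  ring

theorem walkEdges_sdiff_stackEdges_subset_back {v u : V} {a : Bool} {st : List (V × Bool)}
    {w : List Bool} {us : List V}
    (h_count : ∀ e, (stackEdges v ((u, !a) :: st) ++ walkEdges v (a :: w) (u :: us)).count e ≤ 2) :
    (walkEdges u w us).toFinset \ (stackEdges u st).toFinset ⊆
      (walkEdges v (a :: w) (u :: us)).toFinset \ (stackEdges v ((u, !a) :: st)).toFinset := by
  intro e he
  simp only [Finset.mem_sdiff, List.mem_toFinset, stackEdges_cons, walkEdges_cons,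
    List.mem_cons, stepEntry_not, not_or] at he ⊢
  refine ⟨Or.inr he.1, fun h_eq => ?_, he.2⟩
  have h_pos := List.count_pos_iff.2 (List.mem_append_right (stackEdges u st) he.1)
  have h_singleton : [stepEntry a v u].count e = 1 := by simp [h_eq]
  have h_le := h_count e
  rw [count_stackEdges_append_walkEdges_back] at h_le
  omega

theorem stackWalk_of_card_le {w : List Bool} {us : List V} (h_length : us.length = w.length)
    {S : Finset V} {v : V} {st : List (V × Bool)}
    (hS : ∀ p ∈ v :: st.map Prod.fst, p ∈ S) (h_nodup : (v :: st.map Prod.fst).Nodup)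
    (h_count : ∀ e, (stackEdges v st ++ walkEdges v w us).count e = 0 ∨
      (stackEdges v st ++ walkEdges v w us).count e = 2)
    (h_card : ((walkEdges v w us).toFinset \ (stackEdges v st).toFinset).card ≤ newCard S us) :
    StackWalk S v st w us := by
  induction w generalizing us S v st with
  | nil =>
    obtain rfl := List.length_eq_zero_iff.1 h_length
    cases st with
    | nil => exact StackWalk.nil S v
    | cons q st =>
      obtain ⟨p, b⟩ := q
      have h_one := List.count_eq_zero_of_not_mem
        (stepEntry_notMem_stackEdges (List.nodup_cons.1 h_nodup).1 b p)
      have := h_count (stepEntry b p v)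
      simp [stackEdges_cons, walkEdges, walkEntries, h_one] at this
  | cons a w ih =>
    obtain ⟨u, us, rfl⟩ := List.exists_cons_of_length_eq_add_one h_length
    have h_tail : us.length = w.length := by simpa using h_length
    by_cases hu : u ∈ S
    · obtain ⟨st, rfl⟩ := exists_eq_cons_of_card_le h_tail hu hS h_nodup h_card
      refine .pop (ih (v := u) h_tail (List.forall_mem_cons.1 hS).2 (List.nodup_cons.1 h_nodup).2
        (fun e => ?_) ?_)
      · have h_or := h_count e
        rw [count_stackEdges_append_walkEdges_back] at h_or
        omega
      · rw [← newCard_cons_of_mem hu]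
        refine (Finset.card_le_card (walkEdges_sdiff_stackEdges_subset_back fun e => ?_)).trans
          h_card
        rcases h_count e with h | h <;> simp only [h, zero_le, le_refl]
    · have h_new : stepEntry a v u ∉ (stackEdges v st).toFinset := fun h =>
        hu (stepEntry_mem_product.1
          (mem_product_of_mem_stackEdges hS (List.mem_toFinset.1 h))).2
      refine (ih h_tail ?_ ?_ (fun e => ?_) ?_).push hu
      · refine List.forall_mem_cons.2 ⟨Finset.mem_insert_self u S, fun p hp => ?_⟩
        exact Finset.mem_insert_of_mem (hS p hp)
      · exact List.nodup_cons.2 ⟨fun h => hu (hS u h), h_nodup⟩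
      · rw [stackEdges_cons, List.cons_append, ← List.perm_middle.count_eq]
        exact h_count e
      · rw [walkEdges_cons, List.toFinset_cons, newCard_cons_of_notMem hu,
          card_insert_sdiff_of_notMem h_new, Nat.add_le_add_iff_right] at h_card
        rwa [stackEdges_cons, List.toFinset_cons]

theorem StackWalk.exists_perm {S : Finset V} {v : V} {st : List (V × Bool)} {w : List Bool}
    {us : List V} (h : StackWalk S v st w us) (hS : ∀ p ∈ v :: st.map Prod.fst, p ∈ S) :
    ∃ F : List (V × V), F.Nodup ∧ (∀ e ∈ F, e ∉ S ×ˢ S) ∧ F.length = newCard S us ∧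
      List.Perm (walkEntries v w us)
        ((stackEntries v st).map (fun x => (!x.1, x.2)) ++
          F.flatMap fun e => [(true, e), (false, e)]) := by
  induction h with
  | nil S v => exact ⟨[], List.nodup_nil, by simp, by simp [newCard], by
      simp [walkEntries, stackEntries]⟩
  | @push S v u st a w us hu _ ih =>
    have hS_insert : ∀ p ∈ u :: ((v, a) :: st).map Prod.fst, p ∈ insert u S :=
      List.forall_mem_cons.2 ⟨Finset.mem_insert_self u S,
        fun p hp => Finset.mem_insert_of_mem (hS p hp)⟩
    obtain ⟨F, h_nodup, h_new, h_length, h_perm⟩ := ih hS_insert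
    set e := stepEntry a v u with he
    refine ⟨e :: F, List.nodup_cons.2 ⟨fun h => h_new e h ?_, h_nodup⟩,
      List.forall_mem_cons.2 ⟨fun h => hu (stepEntry_mem_product.1 h).2, fun f hf h => ?_⟩, ?_, ?_⟩
    · exact stepEntry_mem_product.2 ⟨hS_insert v (by simp), hS_insert u (by simp)⟩
    · exact h_new f hf (Finset.product_subset_product (Finset.subset_insert u S)
        (Finset.subset_insert u S) h)
    · rw [List.length_cons, h_length, newCard_cons_of_notMem hu]
    · have h_swap : List.Perm [(a, e), (!a, e)] [(true, e), (false, e)] := by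
        cases a
        · exact List.Perm.swap _ _ _
        · exact List.Perm.refl _
      have h_comm := List.perm_append_comm_assoc [(true, e), (false, e)]
        ((stackEntries v st).map fun x => (!x.1, x.2)) (F.flatMap fun e => [(true, e), (false, e)])
      exact (h_perm.cons _).trans ((h_swap.append_right _).trans h_comm)
  | @pop S v p st a w us _ ih =>
    obtain ⟨F, h_nodup, h_new, h_length, h_perm⟩ := ih (List.forall_mem_cons.1 hS).2
    refine ⟨F, h_nodup, h_new, by rw [h_length, newCard_cons_of_mem (hS p (by simp))], ?_⟩
    simp only [walkEntries, stackEntries, List.map_cons, List.cons_append, Bool.not_not,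
      stepEntry_not]
    exact h_perm.cons _



theorem StackWalk.length_word_eq {v : V} {w : List Bool} {us : List V}
    (h : StackWalk {v} v [] w us) (h_length : us.length = w.length) :
    w.length = 2 * newCard {v} us := by
  obtain ⟨F, -, -, hF, h_perm⟩ := h.exists_perm (by simp)
  have h_perm_length := h_perm.length_eq
  simp only [length_walkEntries v w us h_length, stackEntries, List.map_nil, List.nil_append,
    List.length_flatMap, List.length_cons, List.length_nil, List.map_const', List.sum_replicate,
    hF, smul_eq_mul] at h_perm_length
  rw [h_perm_length, mul_comm]

end Walks

section WalkSums

/-- The lists of length `n` with elements in a finite type. -/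
def listsOfLength (V : Type*) [Fintype V] : ℕ → Finset (List V)
  | 0 => {[]}
  | n + 1 => (Finset.univ ×ˢ listsOfLength V n).map
      ⟨fun p => p.1 :: p.2, fun _ _ h => Prod.ext (List.cons.inj h).1 (List.cons.inj h).2⟩

variable {V : Type*} [Fintype V]

theorem sum_listsOfLength_zero {R : Type*} [AddCommMonoid R] (f : List V → R) :
    ∑ us ∈ listsOfLength V 0, f us = f [] :=
  Finset.sum_singleton f []

theorem sum_listsOfLength_succ {R : Type*} [AddCommMonoid R] (n : ℕ) (f : List V → R) :
    ∑ us ∈ listsOfLength V (n + 1), f us = ∑ u, ∑ us ∈ listsOfLength V n, f (u :: us) := by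
  rw [listsOfLength, Finset.sum_map, Finset.sum_product]
  rfl

theorem length_of_mem_listsOfLength {n : ℕ} {us : List V} (h : us ∈ listsOfLength V n) :
    us.length = n := by
  induction n generalizing us with
  | zero => rw [Finset.mem_singleton.1 h, List.length_nil]
  | succ n ih =>
    obtain ⟨p, hp, rfl⟩ := Finset.mem_map.1 h
    exact congrArg (· + 1) (ih (Finset.mem_product.1 hp).2)

variable [DecidableEq V]

theorem sum_pow_newCard_le (n : ℕ) (S : Finset V) :
    ∑ us ∈ listsOfLength V n, ((Fintype.card V : ℝ)⁻¹) ^ newCard S us ≤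
      ((S.card + n + 1 : ℕ) : ℝ) ^ n := by
  set q : ℝ := (Fintype.card V : ℝ)⁻¹
  have hq₀ : 0 ≤ q := inv_nonneg.2 (Nat.cast_nonneg _)
  induction n generalizing S with
  | zero => simp [sum_listsOfLength_zero, newCard]
  | succ n ih =>
    set B : ℝ := ((S.card + (n + 1) + 1 : ℕ) : ℝ) ^ n with hB
    have hB₀ : 0 ≤ B := by positivity
    have h_step (u : V) : ∑ us ∈ listsOfLength V n, q ^ newCard S (u :: us) ≤
        (if u ∈ S then B else 0) + q * B := by
      by_cases hu : u ∈ S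
      · simp only [newCard_cons_of_mem hu, if_pos hu]
        have h_mono : ((S.card + n + 1 : ℕ) : ℝ) ^ n ≤ B :=
          pow_le_pow_left₀ (by positivity) (by exact_mod_cast (by omega)) n
        exact ((ih S).trans h_mono).trans (le_add_of_nonneg_right (mul_nonneg hq₀ hB₀))
      · simp only [newCard_cons_of_notMem hu, if_neg hu, zero_add, pow_succ']
        rw [← Finset.mul_sum]
        refine mul_le_mul_of_nonneg_left ((ih (insert u S)).trans_eq ?_) hq₀
        rw [Finset.card_insert_of_notMem hu, hB, add_assoc S.card 1 n, add_comm 1 n]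
    calc ∑ us ∈ listsOfLength V (n + 1), q ^ newCard S us
        ≤ ∑ u, ((if u ∈ S then B else 0) + q * B) := by
          rw [sum_listsOfLength_succ]
          exact Finset.sum_le_sum fun u _ => h_step u
      _ = S.card * B + Fintype.card V * q * B := by
          rw [Finset.sum_add_distrib, Finset.sum_ite_mem, Finset.univ_inter, Finset.sum_const,
            Finset.sum_const, Finset.card_univ, nsmul_eq_mul, nsmul_eq_mul, mul_assoc]
      _ ≤ S.card * B + 1 * B := by
          gcongr
          exact mul_inv_le_one
      _ ≤ ((S.card + (n + 1) + 1 : ℕ) : ℝ) ^ (n + 1) := by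
          rw [← add_mul, pow_succ']
          gcongr
          push_cast
          linarith [(Nat.cast_nonneg n : (0 : ℝ) ≤ n)]

/-- The number of stack walks along a word above a stack with given letters when `k` of the `N`
vertices have been visited, each weighted by `N⁻¹` to the number of its new vertices. -/
noncomputable def stackWeight (N : ℕ) : List Bool → List Bool → ℕ → ℝ
  | [], [], _ => 1
  | [], _ :: _, _ => 0
  | a :: w, [], k => ((N : ℝ) - k) / N * stackWeight N w [!a] (k + 1)
  | a :: w, b :: s, k => ((N : ℝ) - k) / N * stackWeight N w ((!a) :: b :: s) (k + 1) +
      if a = b then stackWeight N w s k else 0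

theorem tendsto_sub_div_self (k : ℕ) : Tendsto (fun N : ℕ => ((N : ℝ) - k) / N) atTop (𝓝 1) := by
  have h_lim : Tendsto (fun N : ℕ => 1 - (k : ℝ) / N) atTop (𝓝 (1 - 0)) :=
    tendsto_const_nhds.sub (tendsto_const_div_atTop_nhds_zero_nat (k : ℝ))
  rw [sub_zero] at h_lim
  refine h_lim.congr' ?_
  filter_upwards [eventually_ne_atTop 0] with N hN
  rw [sub_div, div_self (Nat.cast_ne_zero.2 hN)]

theorem tendsto_stackWeight (w s : List Bool) (k : ℕ) :
    Tendsto (fun N => stackWeight N w s k) atTop (𝓝 (stackCount w s : ℝ)) := by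
  induction w generalizing s k with
  | nil => cases s <;> simp [stackWeight, stackCount]
  | cons a w ih =>
    cases s with
    | nil =>
      simp only [stackWeight, stackCount]
      simpa using (tendsto_sub_div_self k).mul (ih [!a] (k + 1))
    | cons b s =>
      have h_push := (tendsto_sub_div_self k).mul (ih ((!a) :: b :: s) (k + 1))
      rw [one_mul] at h_push
      simp only [stackWeight, stackCount, Nat.cast_add]
      refine h_push.add ?_
      split_ifs
      · exact ih s k
      · rw [Nat.cast_zero]
        exact tendsto_const_nhds

open Classical in
/-- The number of stack walks along a word, each weighted by the inverse of the number of all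
vertices to the number of its new vertices. -/
noncomputable def stackWalkSum (S : Finset V) (v : V) (st : List (V × Bool)) (w : List Bool) : ℝ :=
  ∑ us ∈ listsOfLength V w.length,
    if StackWalk S v st w us then ((Fintype.card V : ℝ)⁻¹) ^ newCard S us else 0

open Classical in
/-- The part of `stackWalkSum` due to the walks with a given first step. -/
noncomputable def stackWalkSumTo (S : Finset V) (v : V) (st : List (V × Bool)) (a : Bool)
    (w : List Bool) (u : V) : ℝ :=
  ∑ us ∈ listsOfLength V w.length,
    if StackWalk S v st (a :: w) (u :: us) then ((Fintype.card V : ℝ)⁻¹) ^ newCard S (u :: us)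
    else 0

theorem stackWalkSum_cons (S : Finset V) (v : V) (st : List (V × Bool)) (a : Bool) (w : List Bool) :
    stackWalkSum S v st (a :: w) =
      ∑ u ∈ Sᶜ, stackWalkSumTo S v st a w u + ∑ u ∈ S, stackWalkSumTo S v st a w u := by
  rw [Finset.sum_compl_add_sum]
  exact sum_listsOfLength_succ _ _

theorem stackWalkSumTo_of_notMem {S : Finset V} {v u : V} {st : List (V × Bool)}
    (hst : ∀ p ∈ st, p.1 ∈ S) (hu : u ∉ S) (a : Bool) (w : List Bool) :
    stackWalkSumTo S v st a w u =
      (Fintype.card V : ℝ)⁻¹ * stackWalkSum (insert u S) u ((v, a) :: st) w := by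
  classical
  simp only [stackWalkSumTo, stackWalkSum, stackWalk_cons_of_notMem hst hu,
    newCard_cons_of_notMem hu, pow_succ', Finset.mul_sum, mul_ite, mul_zero]

theorem stackWalkSumTo_nil_of_mem {S : Finset V} {u : V} (hu : u ∈ S) (v : V) (a : Bool)
    (w : List Bool) : stackWalkSumTo S v [] a w u = 0 := by
  simp [stackWalkSumTo, stackWalk_cons_of_mem hu]

theorem stackWalkSumTo_cons_of_mem {S : Finset V} {u : V} (hu : u ∈ S) (v p : V) (a b : Bool)
    (st : List (V × Bool)) (w : List Bool) :
    stackWalkSumTo S v ((p, b) :: st) a w u =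
      if u = p then if a = !b then stackWalkSum S p st w else 0 else 0 := by
  classical
  simp only [stackWalkSumTo, stackWalk_cons_of_mem hu, newCard_cons_of_mem hu]
  by_cases hup : u = p
  · subst hup
    by_cases hab : a = !b
    · simp [hab, stackWalkSum]
    · have hba : b ≠ !a := fun h => hab (by rw [h, Bool.not_not])
      simp [hab, hba]
  · simp [hup, Ne.symm hup]

theorem stackWalkSum_eq_stackWeight (w : List Bool) {S : Finset V} {v : V} {st : List (V × Bool)}
    (hS : ∀ p ∈ v :: st.map Prod.fst, p ∈ S) :
    stackWalkSum S v st w = stackWeight (Fintype.card V) w (st.map fun p => !p.2) S.card := by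
  induction w generalizing S v st with
  | nil =>
    cases st with
    | nil => simp [stackWalkSum, sum_listsOfLength_zero, StackWalk.nil, newCard, stackWeight]
    | cons p st =>
      rw [stackWalkSum, List.length_nil, sum_listsOfLength_zero, if_neg (fun h => by cases h)]
      rfl
  | cons a w ih =>
    have h_push : ∑ u ∈ Sᶜ, stackWalkSumTo S v st a w u =
        ((Fintype.card V : ℝ) - S.card) / Fintype.card V *
          stackWeight (Fintype.card V) w ((!a) :: st.map fun p => !p.2) (S.card + 1) := by
      have h_term {u : V} (hu : u ∈ Sᶜ) : stackWalkSumTo S v st a w u =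
          (Fintype.card V : ℝ)⁻¹ *
            stackWeight (Fintype.card V) w ((!a) :: st.map fun p => !p.2) (S.card + 1) := by
        rw [stackWalkSumTo_of_notMem (by simp_all) (Finset.mem_compl.1 hu), ih,
          Finset.card_insert_of_notMem (Finset.mem_compl.1 hu), List.map_cons]
        exact List.forall_mem_cons.2 ⟨Finset.mem_insert_self u S,
          fun p hp => Finset.mem_insert_of_mem (hS p hp)⟩
      rw [Finset.sum_congr rfl fun u hu => h_term hu, Finset.sum_const, Finset.card_compl,
        nsmul_eq_mul, Nat.cast_sub (Finset.card_le_univ S)]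
      ring
    rw [stackWalkSum_cons, h_push]
    cases st with
    | nil => simp [Finset.sum_congr rfl fun _ hu => stackWalkSumTo_nil_of_mem hu v a w, stackWeight]
    | cons q st =>
      obtain ⟨p, b⟩ := q
      have hp : p ∈ S := hS p (by simp)
      rw [Finset.sum_congr rfl fun u hu => stackWalkSumTo_cons_of_mem hu v p a b st w,
        Finset.sum_ite_eq' S p, if_pos hp, ih (List.forall_mem_cons.1 hS).2]
      simp only [List.map_cons, stackWeight]

end WalkSums

section MomentWeights

variable {V : Type*} [DecidableEq V]

theorem count_true_add_count_false (l : List (Bool × (V × V))) (e : V × V) :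
    l.count (true, e) + l.count (false, e) = (l.map Prod.snd).count e := by
  induction l with
  | nil => rfl
  | cons x l ih =>
    obtain ⟨a, f⟩ := x
    rw [List.map_cons, List.count_cons, List.count_cons, List.count_cons, ← ih]
    cases a <;> by_cases h : f = e <;> simp [h] <;> omega

theorem count_flatMap_pair (F : List (V × V)) (a : Bool) (e : V × V) :
    (F.flatMap fun e => [(true, e), (false, e)]).count (a, e) = F.count e := by
  induction F with
  | nil => rfl
  | cons f F ih =>
    rw [List.flatMap_cons, List.count_append, ih, List.count_cons]
    cases a <;> by_cases h : f = e <;> simp [h] <;> omega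

/-- Bounds on mixed moments `M a b`: with `q` the inverse dimension, those of the normalized entries
of a random matrix are at most `q`, and apart from the second ones smaller by a factor `η`. -/
structure HasSmallMixedMoments (M : ℕ → ℕ → ℂ) (q η : ℝ) : Prop where
  zero_zero : M 0 0 = 1
  norm_le (a b : ℕ) (h : a + b ≠ 0) : ‖M a b‖ ≤ q
  norm_le_mul (a b : ℕ) (h₀ : a + b ≠ 0) (h₂ : a + b ≠ 2) : ‖M a b‖ ≤ q * η

variable {M : ℕ → ℕ → ℂ} {q η : ℝ}

theorem HasSmallMixedMoments.norm_prod_le (hM : HasSmallMixedMoments M q η)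
    {l : List (Bool × (V × V))} {T : Finset (V × V)} (hT : ∀ e ∈ T, e ∈ l.map Prod.snd) :
    ‖∏ e ∈ T, M (l.count (true, e)) (l.count (false, e))‖ ≤ q ^ T.card := by
  rw [norm_prod, ← Finset.prod_const]
  refine Finset.prod_le_prod (fun _ _ => norm_nonneg _) fun e he => hM.norm_le _ _ ?_
  rw [count_true_add_count_false]
  exact (List.count_pos_iff.2 (hT e he)).ne'

variable [Fintype V]

/-- The expectation of a product of independent entries and their conjugates, one factor for each
element of a list, if all entries have the mixed moments `M a b = 𝔼[zᵃ z̄ᵇ]`. -/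
def momentWeight (M : ℕ → ℕ → ℂ) (l : List (Bool × (V × V))) : ℂ :=
  ∏ e, M (l.count (true, e)) (l.count (false, e))

theorem momentWeight_eq_prod (hM : M 0 0 = 1) (l : List (Bool × (V × V))) :
    momentWeight M l =
      ∏ e ∈ (l.map Prod.snd).toFinset, M (l.count (true, e)) (l.count (false, e)) := by
  refine (Finset.prod_subset (Finset.subset_univ _) fun e _ he => ?_).symm
  have h_sum := count_true_add_count_false l e
  rw [List.count_eq_zero_of_not_mem (fun h => he (List.mem_toFinset.2 h))] at h_sum
  obtain ⟨h_true, h_false⟩ := Nat.add_eq_zero_iff.1 h_sum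
  rw [h_true, h_false, hM]

theorem momentWeight_of_perm_pairs (hM : M 0 0 = 1) {l : List (Bool × (V × V))}
    {F : List (V × V)} (hF : F.Nodup)
    (hl : List.Perm l (F.flatMap fun e => [(true, e), (false, e)])) :
    momentWeight M l = M 1 1 ^ F.length := by
  have h_count (a : Bool) (e : V × V) : l.count (a, e) = F.count e := by
    rw [hl.count_eq, count_flatMap_pair]
  have h_snd : (l.map Prod.snd).toFinset = F.toFinset := by
    ext e
    simp only [List.mem_toFinset, ← List.count_pos_iff, ← count_true_add_count_false, h_count]
    omega
  rw [momentWeight_eq_prod hM, h_snd, ← List.toFinset_card_of_nodup hF]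
  refine Finset.prod_eq_pow_card fun e he => ?_
  rw [h_count, h_count, List.count_eq_one_of_mem hF (List.mem_toFinset.1 he)]

theorem HasSmallMixedMoments.norm_momentWeight_le (hM : HasSmallMixedMoments M q η)
    (l : List (Bool × (V × V))) :
    ‖momentWeight M l‖ ≤ q ^ (l.map Prod.snd).toFinset.card := by
  rw [momentWeight_eq_prod hM.zero_zero]
  exact hM.norm_prod_le fun e => List.mem_toFinset.1

theorem HasSmallMixedMoments.norm_momentWeight_le_mul (hM : HasSmallMixedMoments M q η)
    (l : List (Bool × (V × V))) {e : V × V} (h₀ : (l.map Prod.snd).count e ≠ 0)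
    (h₂ : (l.map Prod.snd).count e ≠ 2) :
    ‖momentWeight M l‖ ≤ η * q ^ (l.map Prod.snd).toFinset.card := by
  have h_mem : e ∈ (l.map Prod.snd).toFinset :=
    List.mem_toFinset.2 (List.count_pos_iff.1 (Nat.pos_of_ne_zero h₀))
  have h_rest := hM.norm_prod_le (l := l) (T := (l.map Prod.snd).toFinset.erase e)
    fun f hf => List.mem_toFinset.1 (Finset.mem_of_mem_erase hf)
  rw [← count_true_add_count_false] at h₀ h₂
  have h_e := hM.norm_le_mul _ _ h₀ h₂
  rw [momentWeight_eq_prod hM.zero_zero, ← Finset.mul_prod_erase _ _ h_mem, norm_mul]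
  refine (mul_le_mul h_e h_rest (norm_nonneg _) ((norm_nonneg _).trans h_e)).trans_eq ?_
  rw [← Finset.card_erase_add_one h_mem, pow_succ]
  ring

end MomentWeights

section WalkMoments

variable {V : Type*} [Fintype V] [DecidableEq V] {w : List Bool} {us : List V} {v : V}

theorem StackWalk.momentWeight_eq (h : StackWalk {v} v [] w us) {M : ℕ → ℕ → ℂ}
    (hM : M 0 0 = 1) : momentWeight M (walkEntries v w us) = M 1 1 ^ newCard {v} us := by
  obtain ⟨F, h_nodup, -, h_card, h_perm⟩ := h.exists_perm (by simp)
  rw [← h_card]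
  exact momentWeight_of_perm_pairs hM h_nodup h_perm

variable {M : ℕ → ℕ → ℂ} {η : ℝ}

/-- A walk which is not a stack walk has either fewer new vertices than edges, or an edge whose
multiplicity is not two. -/
theorem norm_momentWeight_le_of_not_stackWalk
    (hM : HasSmallMixedMoments M (Fintype.card V : ℝ)⁻¹ η) (h_length : us.length = w.length)
    (h : ¬ StackWalk {v} v [] w us) :
    ‖momentWeight M (walkEntries v w us)‖ ≤
      max η (Fintype.card V : ℝ)⁻¹ * (Fintype.card V : ℝ)⁻¹ ^ newCard {v} us := by
  set q : ℝ := (Fintype.card V : ℝ)⁻¹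
  have hq₀ : 0 ≤ q := inv_nonneg.2 (Nat.cast_nonneg _)
  have hq₁ : q ≤ 1 := Nat.cast_inv_le_one _
  have h_le : newCard {v} us ≤ (walkEdges v w us).toFinset.card :=
    (newCard_le_card_walkEdges h_length (Finset.mem_singleton_self v)).trans
      (Finset.card_le_card Finset.sdiff_subset)
  rcases h_le.lt_or_eq with h_lt | h_eq
  · calc ‖momentWeight M (walkEntries v w us)‖
        ≤ q ^ (walkEdges v w us).toFinset.card := hM.norm_momentWeight_le _
      _ ≤ q ^ (newCard {v} us + 1) := pow_le_pow_of_le_one hq₀ hq₁ h_lt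
      _ = q * q ^ newCard {v} us := pow_succ' _ _
      _ ≤ _ := mul_le_mul_of_nonneg_right (le_max_right _ _) (pow_nonneg hq₀ _)
  · obtain ⟨e, h₀, h₂⟩ : ∃ e, (walkEdges v w us).count e ≠ 0 ∧ (walkEdges v w us).count e ≠ 2 := by
      by_contra! h_count
      refine h (stackWalk_of_card_le h_length (by simp) (by simp) (fun e => ?_) ?_)
      · exact or_iff_not_imp_left.2 (h_count e)
      · exact (Finset.card_le_card Finset.sdiff_subset).trans h_eq.ge
    calc ‖momentWeight M (walkEntries v w us)‖
        ≤ η * q ^ (walkEdges v w us).toFinset.card := hM.norm_momentWeight_le_mul _ h₀ h₂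
      _ = η * q ^ newCard {v} us := by rw [h_eq]
      _ ≤ _ := mul_le_mul_of_nonneg_right (le_max_left _ _) (pow_nonneg hq₀ _)

open Classical in
theorem norm_momentWeight_sub_stackWalk_le
    (hM : HasSmallMixedMoments M (Fintype.card V : ℝ)⁻¹ η) (h_length : us.length = w.length)
    (v : V) :
    ‖(if walkEnd v us = v then momentWeight M (walkEntries v w us) else 0) -
      ((Fintype.card V : ℂ) * M 1 1) ^ (w.length / 2) *
        ((if StackWalk {v} v [] w us then (Fintype.card V : ℝ)⁻¹ ^ newCard {v} us else 0 : ℝ) : ℂ)‖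
      ≤ max η (Fintype.card V : ℝ)⁻¹ * (Fintype.card V : ℝ)⁻¹ ^ newCard {v} us := by
  have h_nonneg : 0 ≤ max η (Fintype.card V : ℝ)⁻¹ * (Fintype.card V : ℝ)⁻¹ ^ newCard {v} us :=
    mul_nonneg (le_max_of_le_right (by positivity)) (by positivity)
  by_cases h : StackWalk {v} v [] w us
  · have h_card : (Fintype.card V : ℂ) ≠ 0 :=
      Nat.cast_ne_zero.2 (Fintype.card_pos_iff.2 ⟨v⟩).ne'
    have h_half : w.length / 2 = newCard {v} us := by
      rw [h.length_word_eq h_length, Nat.mul_div_cancel_left _ two_pos]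
    have h_end : walkEnd v us = v := h.walkEnd_eq
    rw [if_pos h_end, if_pos h, h.momentWeight_eq hM.zero_zero, h_half, Complex.ofReal_pow,
      Complex.ofReal_inv, Complex.ofReal_natCast, ← mul_pow, mul_right_comm,
      mul_inv_cancel₀ h_card, one_mul, sub_self, norm_zero]
    exact h_nonneg
  · rw [if_neg h, Complex.ofReal_zero, mul_zero, sub_zero]
    split_ifs
    · exact norm_momentWeight_le_of_not_stackWalk hM h_length h
    · rwa [norm_zero]

theorem norm_sum_momentWeight_sub_stackWeight_le
    (hM : HasSmallMixedMoments M (Fintype.card V : ℝ)⁻¹ η) (w : List Bool) (v : V) :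
    ‖(∑ us ∈ listsOfLength V w.length,
        if walkEnd v us = v then momentWeight M (walkEntries v w us) else 0) -
      ((Fintype.card V : ℂ) * M 1 1) ^ (w.length / 2) *
        (stackWeight (Fintype.card V) w [] 1 : ℝ)‖
      ≤ max η (Fintype.card V : ℝ)⁻¹ * ((w.length + 2 : ℕ) : ℝ) ^ w.length := by
  have h_stack : stackWalkSum {v} v [] w = stackWeight (Fintype.card V) w [] 1 :=
    stackWalkSum_eq_stackWeight w (by simp)
  have h_number := sum_pow_newCard_le w.length {v}
  rw [Finset.card_singleton, add_comm 1, add_assoc] at h_number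
  rw [← h_stack, stackWalkSum, Complex.ofReal_sum, Finset.mul_sum, ← Finset.sum_sub_distrib]
  calc _ ≤ ∑ us ∈ listsOfLength V w.length,
        max η (Fintype.card V : ℝ)⁻¹ * (Fintype.card V : ℝ)⁻¹ ^ newCard {v} us :=
        norm_sum_le_of_le _ fun us hus =>
          norm_momentWeight_sub_stackWalk_le hM (length_of_mem_listsOfLength hus) v
    _ ≤ _ := by
        rw [← Finset.mul_sum]
        exact mul_le_mul_of_nonneg_left h_number (le_max_of_le_right (by positivity))

end WalkMoments

section WordProducts

variable {V : Type*}

/-- The product over a list of the entries of `A` (for `true`) and of their conjugates (for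
`false`). -/
def entryProd (A : V × V → ℂ) (l : List (Bool × (V × V))) : ℂ :=
  (l.map fun x => if x.1 then A x.2 else star (A x.2)).prod

theorem entryProd_cons (A : V × V → ℂ) (x : Bool × (V × V)) (l : List (Bool × (V × V))) :
    entryProd A (x :: l) = (if x.1 then A x.2 else star (A x.2)) * entryProd A l :=
  List.prod_cons

theorem norm_entryProd_le {A : V × V → ℂ} {C : ℝ} (hA : ∀ e, ‖A e‖ ≤ C)
    (l : List (Bool × (V × V))) : ‖entryProd A l‖ ≤ C ^ l.length := by
  induction l with
  | nil => simp [entryProd]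
  | cons x l ih =>
    have h_factor : ‖(if x.1 then A x.2 else star (A x.2))‖ ≤ C := by
      split_ifs
      · exact hA _
      · exact (norm_star _).trans_le (hA _)
    rw [entryProd_cons, norm_mul, List.length_cons, pow_succ']
    exact mul_le_mul h_factor ih (norm_nonneg _) ((norm_nonneg _).trans h_factor)

variable [Fintype V] [DecidableEq V]

theorem entryProd_eq_prod (A : V × V → ℂ) (l : List (Bool × (V × V))) :
    entryProd A l = ∏ e, (A e ^ l.count (true, e) * star (A e) ^ l.count (false, e)) := by
  induction l with
  | nil => simp [entryProd]
  | cons x l ih =>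
    obtain ⟨a, f⟩ := x
    have h_factor : (if a then A f else star (A f)) =
        ∏ e, if e = f then (if a then A e else star (A e)) else 1 := by
      rw [Finset.prod_ite_eq' Finset.univ f, if_pos (Finset.mem_univ f)]
    rw [entryProd_cons, h_factor, ih, ← Finset.prod_mul_distrib]
    refine Finset.prod_congr rfl fun e _ => ?_
    rw [List.count_cons, List.count_cons]
    by_cases h : e = f
    · subst h
      cases a <;> simp [pow_succ] <;> ring
    · simp [h, Ne.symm h]

/-- The product of matrices `A` (for `true`) and `Aᴴ` (for `false`) along a word. -/
def wordProd (A : Matrix V V ℂ) (w : List Bool) : Matrix V V ℂ :=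
  (w.map fun a => if a then A else Aᴴ).prod

theorem wordProd_cons (A : Matrix V V ℂ) (a : Bool) (w : List Bool) :
    wordProd A (a :: w) = (if a then A else Aᴴ) * wordProd A w :=
  List.prod_cons

theorem wordProd_append (A : Matrix V V ℂ) (w w' : List Bool) :
    wordProd A (w ++ w') = wordProd A w * wordProd A w' := by
  rw [wordProd, List.map_append, List.prod_append, wordProd, wordProd]

theorem wordProd_apply (A : Matrix V V ℂ) (w : List Bool) (v z : V) :
    wordProd A w v z = ∑ us ∈ listsOfLength V w.length, if walkEnd v us = z then
      entryProd (fun e => A e.1 e.2) (walkEntries v w us) else 0 := by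
  induction w generalizing v with
  | nil =>
    rw [List.length_nil, sum_listsOfLength_zero]
    simp [wordProd, walkEnd, walkEntries, entryProd, Matrix.one_apply]
  | cons a w ih =>
    rw [wordProd_cons, Matrix.mul_apply, List.length_cons, sum_listsOfLength_succ]
    refine Finset.sum_congr rfl fun u _ => ?_
    rw [ih, Finset.mul_sum]
    refine Finset.sum_congr rfl fun us _ => ?_
    rw [mul_ite, mul_zero, walkEnd, walkEntries, entryProd_cons]
    cases a <;> simp [stepEntry, Matrix.conjTranspose_apply]

theorem window_eq_replicate {l : ℕ → Bool} {b : Bool} {i n : ℕ}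
    (h : ∀ j, i ≤ j → j < i + n → l j = b) : window l i n = List.replicate n b := by
  rw [window, List.map_eq_replicate_iff.2, List.length_range']
  intro j hj
  obtain ⟨h_le, h_lt⟩ := List.mem_range'_1.1 hj
  exact h j h_le h_lt

theorem window_zigzag_period (m : ℕ) :
    window (zigzag m) 0 (2 * m) = List.replicate m true ++ List.replicate m false := by
  rw [two_mul, window_add, window_eq_replicate (b := true), window_eq_replicate (b := false)]
  · intro j h_le h_lt
    simp only [zigzag, decide_eq_false_iff_not]
    rw [Nat.mod_eq_of_lt (by omega)]
    omega
  · intro j _ h_lt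
    simp only [zigzag, decide_eq_true_eq]
    rw [Nat.mod_eq_of_lt (by omega)]
    omega

theorem wordProd_zigzag {N : ℕ} (m p : ℕ) (A : Matrix (Fin N) (Fin N) ℂ) :
    wordProd A (window (zigzag m) 0 (2 * m * p)) = powerGram m A ^ p := by
  induction p with
  | zero => rfl
  | succ p ih =>
    have h_period : wordProd A (window (zigzag m) 0 (2 * m)) = powerGram m A := by
      rw [window_zigzag_period]
      simp [wordProd, powerGram]
    rw [Nat.mul_succ, Nat.add_comm, window_add, window_add_period (zigzag_periodic m),
      wordProd_append, h_period, ih, pow_succ']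

end WordProducts

section ExpectedTraces

variable {Ω₀ Ω : Type*} [MeasurableSpace Ω₀] [MeasurableSpace Ω] {P₀ : Measure Ω₀} {P : Measure Ω}

/-- The mixed moments `𝔼[yᵃ ȳᵇ]` of a complex random variable. -/
noncomputable def mixedMoment (P₀ : Measure Ω₀) (y : Ω₀ → ℂ) (a b : ℕ) : ℂ :=
  ∫ ω, y ω ^ a * star (y ω) ^ b ∂P₀

theorem integrable_entryProd {V : Type*} {Y : V × V → Ω → ℂ} [IsFiniteMeasure P]
    (hY : ∀ e, AEMeasurable (Y e) P) {C : ℝ} (hC : ∀ e ω, ‖Y e ω‖ ≤ C) (l : List (Bool × (V × V))) :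
    Integrable (fun ω => entryProd (fun e => Y e ω) l) P := by
  refine Integrable.of_bound (AEMeasurable.aestronglyMeasurable ?_) (C ^ l.length)
    (ae_of_all _ fun ω => norm_entryProd_le (fun e => hC e ω) l)
  induction l with
  | nil => exact aemeasurable_const
  | cons x l ih =>
    simp only [entryProd_cons]
    refine AEMeasurable.mul ?_ ih
    split_ifs
    · exact hY x.2
    · exact continuous_star.measurable.comp_aemeasurable (hY x.2)

section FixedDimension

variable {V : Type*} [Fintype V] [DecidableEq V] {y : Ω₀ → ℂ} {Y : V × V → Ω → ℂ}

theorem integral_entryProd (hY : ∀ e, IdentDistrib (Y e) y P P₀) (h_indep : iIndepFun Y P)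
    (l : List (Bool × (V × V))) :
    ∫ ω, entryProd (fun e => Y e ω) l ∂P = momentWeight (mixedMoment P₀ y) l := by
  have h_meas (a b : ℕ) : Measurable fun z : ℂ => z ^ a * star z ^ b :=
    (measurable_id.pow_const _).mul (continuous_star.measurable.pow_const _)
  simp only [entryProd_eq_prod]
  rw [h_indep.integral_fun_prod_comp
    (f := fun e z => z ^ l.count (true, e) * star z ^ l.count (false, e))
    (fun e => (hY e).aemeasurable_fst) (fun e => (h_meas _ _).aestronglyMeasurable)]
  exact Finset.prod_congr rfl fun e _ => ((hY e).comp (h_meas _ _)).integral_eq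

theorem integral_trace_wordProd [IsFiniteMeasure P] (hY : ∀ e, IdentDistrib (Y e) y P P₀)
    (h_indep : iIndepFun Y P) {C : ℝ} (hC : ∀ e ω, ‖Y e ω‖ ≤ C) (w : List Bool) :
    ∫ ω, (wordProd (Matrix.of fun i j => Y (i, j) ω) w).trace ∂P =
      ∑ v, ∑ us ∈ listsOfLength V w.length, if walkEnd v us = v then
        momentWeight (mixedMoment P₀ y) (walkEntries v w us) else 0 := by
  have h_int (v : V) (us : List V) : Integrable (fun ω => if walkEnd v us = v then
      entryProd (fun e => Matrix.of (fun i j => Y (i, j) ω) e.1 e.2) (walkEntries v w us)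
      else 0) P := by
    split_ifs
    · exact integrable_entryProd (fun e => (hY e).aemeasurable_fst) hC _
    · exact integrable_zero _ _ _
  simp only [Matrix.trace, Matrix.diag_apply, wordProd_apply]
  rw [integral_finsetSum _ fun v _ => integrable_finsetSum _ fun us _ => h_int v us]
  refine Finset.sum_congr rfl fun v _ => ?_
  rw [integral_finsetSum _ fun us _ => h_int v us]
  refine Finset.sum_congr rfl fun us _ => ?_
  split_ifs
  · exact integral_entryProd hY h_indep _
  · exact integral_zero _ _

theorem norm_integral_trace_sub_stackWeight_le [Nonempty V] [IsFiniteMeasure P]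
    (hY : ∀ e, IdentDistrib (Y e) y P P₀) (h_indep : iIndepFun Y P) {C : ℝ}
    (hC : ∀ e ω, ‖Y e ω‖ ≤ C) {η : ℝ}
    (h_moments : HasSmallMixedMoments (mixedMoment P₀ y) (Fintype.card V : ℝ)⁻¹ η)
    (w : List Bool) :
    ‖(Fintype.card V : ℂ)⁻¹ * ∫ ω, (wordProd (Matrix.of fun i j => Y (i, j) ω) w).trace ∂P -
      ((Fintype.card V : ℂ) * mixedMoment P₀ y 1 1) ^ (w.length / 2) *
        (stackWeight (Fintype.card V) w [] 1 : ℝ)‖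
      ≤ max η (Fintype.card V : ℝ)⁻¹ * ((w.length + 2 : ℕ) : ℝ) ^ w.length := by
  rw [integral_trace_wordProd hY h_indep hC]
  set A : ℂ := ((Fintype.card V : ℂ) * mixedMoment P₀ y 1 1) ^ (w.length / 2) *
    (stackWeight (Fintype.card V) w [] 1 : ℝ)
  set B : ℝ := max η (Fintype.card V : ℝ)⁻¹ * ((w.length + 2 : ℕ) : ℝ) ^ w.length
  have hA : A = (Fintype.card V : ℂ)⁻¹ * ∑ _v : V, A := by
    rw [Finset.sum_const, Finset.card_univ, nsmul_eq_mul,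
      inv_mul_cancel_left₀ (Nat.cast_ne_zero.2 Fintype.card_ne_zero)]
  have hB : B = (Fintype.card V : ℝ)⁻¹ * ∑ _v : V, B := by
    rw [Finset.sum_const, Finset.card_univ, nsmul_eq_mul,
      inv_mul_cancel_left₀ (Nat.cast_ne_zero.2 Fintype.card_ne_zero)]
  rw [hA, hB, ← mul_sub, ← Finset.sum_sub_distrib, norm_mul, norm_inv, Complex.norm_natCast]
  exact mul_le_mul_of_nonneg_left (norm_sum_le_of_le _ fun v _ =>
    norm_sum_momentWeight_sub_stackWeight_le h_moments w v) (by positivity)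

end FixedDimension

theorem tendsto_integral_trace_wordProd [IsFiniteMeasure P] {y : ℕ → Ω₀ → ℂ}
    {Y : (N : ℕ) → Fin N × Fin N → Ω → ℂ} (hY : ∀ N e, IdentDistrib (Y N e) (y N) P P₀)
    (h_indep : ∀ N, iIndepFun (Y N) P) {C : ℕ → ℝ} (hC : ∀ N e ω, ‖Y N e ω‖ ≤ C N)
    {η : ℕ → ℝ} (hη : Tendsto η atTop (𝓝 0))
    (h_moments : ∀ᶠ N : ℕ in atTop, HasSmallMixedMoments (mixedMoment P₀ (y N)) (N : ℝ)⁻¹ (η N))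
    (h_second : Tendsto (fun N : ℕ => (N : ℂ) * mixedMoment P₀ (y N) 1 1) atTop (𝓝 1))
    (w : List Bool) :
    Tendsto (fun N : ℕ => (N : ℂ)⁻¹ *
      ∫ ω, (wordProd (Matrix.of fun i j => Y N (i, j) ω) w).trace ∂P) atTop
      (𝓝 (stackCount w [] : ℂ)) := by
  have h_main : Tendsto (fun N : ℕ => ((N : ℂ) * mixedMoment P₀ (y N) 1 1) ^ (w.length / 2) *
      (stackWeight N w [] 1 : ℝ)) atTop (𝓝 (stackCount w [] : ℂ)) := by
    simpa using (h_second.pow (w.length / 2)).mul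
      ((Complex.continuous_ofReal.tendsto _).comp (tendsto_stackWeight w [] 1))
  have h_error : Tendsto (fun N : ℕ =>
      max (η N) (N : ℝ)⁻¹ * ((w.length + 2 : ℕ) : ℝ) ^ w.length) atTop (𝓝 0) := by
    simpa using (hη.max tendsto_inv_atTop_nhds_zero_nat).mul_const
      (((w.length + 2 : ℕ) : ℝ) ^ w.length)
  refine h_main.congr_dist (squeeze_zero' (Eventually.of_forall fun _ => dist_nonneg) ?_ h_error)
  filter_upwards [h_moments, eventually_gt_atTop 0] with N hN h_pos
  have : Nonempty (Fin N) := ⟨⟨0, h_pos⟩⟩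
  rw [dist_comm, dist_eq_norm]
  simpa using norm_integral_trace_sub_stackWeight_le (hY N) (h_indep N) (hC N)
    (by rwa [Fintype.card_fin]) w

theorem tendsto_integral_trace_powerGram [IsFiniteMeasure P] {y : ℕ → Ω₀ → ℂ}
    {Y : (N : ℕ) → Fin N × Fin N → Ω → ℂ} (hY : ∀ N e, IdentDistrib (Y N e) (y N) P P₀)
    (h_indep : ∀ N, iIndepFun (Y N) P) {C : ℕ → ℝ} (hC : ∀ N e ω, ‖Y N e ω‖ ≤ C N)
    {η : ℕ → ℝ} (hη : Tendsto η atTop (𝓝 0))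
    (h_moments : ∀ᶠ N : ℕ in atTop, HasSmallMixedMoments (mixedMoment P₀ (y N)) (N : ℝ)⁻¹ (η N))
    (h_second : Tendsto (fun N : ℕ => (N : ℂ) * mixedMoment P₀ (y N) 1 1) atTop (𝓝 1))
    (m p : ℕ) :
    Tendsto (fun N : ℕ => (N : ℂ)⁻¹ *
      ∫ ω, (powerGram m (Matrix.of fun i j => Y N (i, j) ω) ^ p).trace ∂P) atTop
      (𝓝 (fussCatalan m p : ℂ)) := by
  rw [← stackCount_zigzag, Complex.ofReal_natCast]
  simpa only [wordProd_zigzag] using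
    tendsto_integral_trace_wordProd hY h_indep hC hη h_moments h_second
      (window (zigzag m) 0 (2 * m * p))

end ExpectedTraces

section Truncation

variable {μ : Measure ℂ}

/-- The part of the fourth absolute moment of a law on `ℂ` that lies outside of the disc of
radius `r`. -/
noncomputable def fourthTail (μ : Measure ℂ) (r : ℝ) : ℝ :=
  ∫ z in {z | r < ‖z‖}, ‖z‖ ^ 4 ∂μ

theorem measurableSet_lt_norm (r : ℝ) : MeasurableSet {z : ℂ | r < ‖z‖} :=
  measurableSet_lt measurable_const measurable_norm

theorem fourthTail_nonneg (r : ℝ) : 0 ≤ fourthTail μ r :=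
  integral_nonneg fun _ => by positivity

theorem fourthTail_antitone (h_four : Integrable (fun z : ℂ => ‖z‖ ^ 4) μ) :
    Antitone (fourthTail μ) := fun _ _ h =>
  setIntegral_mono_set h_four.integrableOn (ae_of_all _ fun _ => by positivity)
    (ae_of_all _ fun _ hz => h.trans_lt hz)

theorem tendsto_fourthTail (h_four : Integrable (fun z : ℂ => ‖z‖ ^ 4) μ) {r : ℕ → ℝ}
    (hr : Tendsto r atTop atTop) : Tendsto (fun N => fourthTail μ (r N)) atTop (𝓝 0) := by
  simp only [fourthTail, ← integral_indicator (measurableSet_lt_norm _)]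
  rw [← integral_zero ℂ ℝ (μ := μ)]
  refine tendsto_integral_of_dominated_convergence (fun z => ‖z‖ ^ 4)
    (fun N => (h_four.indicator (measurableSet_lt_norm _)).aestronglyMeasurable) h_four
    (fun N => ae_of_all _ fun z => ?_) (ae_of_all _ fun z => ?_)
  · exact (norm_indicator_le_norm_self _ z).trans_eq (by simp)
  · refine tendsto_const_nhds.congr' ?_
    filter_upwards [hr.eventually_ge_atTop ‖z‖] with N hN
    exact (Set.indicator_of_notMem (not_lt.2 hN) _).symm

theorem pow_mul_setIntegral_norm_pow_le_fourthTail
    (h_four : Integrable (fun z : ℂ => ‖z‖ ^ 4) μ) {r : ℝ} (hr : 0 ≤ r) {i j : ℕ}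
    (hij : i + j = 4) : r ^ i * ∫ z in {z | r < ‖z‖}, ‖z‖ ^ j ∂μ ≤ fourthTail μ r := by
  rw [fourthTail, ← integral_const_mul]
  refine integral_mono_of_nonneg (ae_of_all _ fun z => by positivity) h_four.integrableOn ?_
  filter_upwards [ae_restrict_mem (measurableSet_lt_norm r)] with z hz
  rw [← hij, pow_add]
  exact mul_le_mul_of_nonneg_right (pow_le_pow_left₀ hr (le_of_lt hz) i)
    (pow_nonneg (norm_nonneg z) j)

theorem exists_truncation_level (h_four : Integrable (fun z : ℂ => ‖z‖ ^ 4) μ) :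
    ∃ δ : ℕ → ℝ, Tendsto δ atTop (𝓝 0) ∧ Tendsto (fun N : ℕ => δ N * √N) atTop atTop ∧
      Tendsto (fun N : ℕ => fourthTail μ (δ N * √N) / δ N ^ 4) atTop (𝓝 0) := by
  set r : ℕ → ℝ := fun N => √(√N)
  set s : ℕ → ℝ := fun N => √(√(√(fourthTail μ (r N)))) with hs
  set δ : ℕ → ℝ := fun N => max (s N) (r N)⁻¹
  have hr_top : Tendsto r atTop atTop :=
    Real.tendsto_sqrt_atTop.comp (Real.tendsto_sqrt_atTop.comp tendsto_natCast_atTop_atTop)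
  have hs_zero : Tendsto s atTop (𝓝 0) := by
    simpa using (tendsto_fourthTail h_four hr_top).sqrt.sqrt.sqrt
  have hs_pow (N : ℕ) : s N ^ 8 = fourthTail μ (r N) := by
    rw [hs, show (8 : ℕ) = 2 * (2 * 2) by norm_num, pow_mul, pow_mul,
      Real.sq_sqrt (Real.sqrt_nonneg _), Real.sq_sqrt (Real.sqrt_nonneg _),
      Real.sq_sqrt (fourthTail_nonneg _)]
  have hδ_nonneg (N : ℕ) : 0 ≤ δ N := le_max_of_le_left (Real.sqrt_nonneg _)
  have hr_le (N : ℕ) : r N ≤ δ N * √N := by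
    have hr_sq : r N * r N = √N := Real.mul_self_sqrt (Real.sqrt_nonneg _)
    calc r N = (r N)⁻¹ * √N := by rw [← hr_sq, ← mul_assoc, inv_mul_mul_self]
      _ ≤ δ N * √N := mul_le_mul_of_nonneg_right (le_max_right _ _) (Real.sqrt_nonneg _)
  have hδ_zero : Tendsto δ atTop (𝓝 0) := by
    simpa using hs_zero.max (tendsto_inv_atTop_zero.comp hr_top)
  refine ⟨δ, hδ_zero, tendsto_atTop_mono hr_le hr_top,
    squeeze_zero (g := fun N => δ N ^ 4)
      (fun N => div_nonneg (fourthTail_nonneg _) (pow_nonneg (hδ_nonneg N) 4))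
      (fun N => ?_) (by simpa using hδ_zero.pow 4)⟩
  refine div_le_of_le_mul₀ (pow_nonneg (hδ_nonneg N) 4) (pow_nonneg (hδ_nonneg N) 4) ?_
  calc fourthTail μ (δ N * √N) ≤ fourthTail μ (r N) := fourthTail_antitone h_four (hr_le N)
    _ = s N ^ 8 := (hs_pow N).symm
    _ ≤ δ N ^ 8 := pow_le_pow_left₀ (Real.sqrt_nonneg _) (le_max_left _ _) 8
    _ = δ N ^ 4 * δ N ^ 4 := by ring

/-- The entry of the `N × N` matrix obtained from the value `z` of a random variable: truncation
at radius `r`, followed by division by `√N`. -/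
noncomputable def truncScale (N : ℕ) (r : ℝ) (z : ℂ) : ℂ :=
  ((√N : ℝ) : ℂ)⁻¹ * (Metric.closedBall 0 r).indicator id z

theorem truncScale_of_norm_le {N : ℕ} {r : ℝ} {z : ℂ} (hz : ‖z‖ ≤ r) :
    truncScale N r z = ((√N : ℝ) : ℂ)⁻¹ * z := by
  rw [truncScale, Set.indicator_of_mem (mem_closedBall_zero_iff.2 hz), id]

theorem measurable_truncScale (N : ℕ) (r : ℝ) : Measurable (truncScale N r) :=
  (measurable_id.indicator measurableSet_closedBall).const_mul _

theorem norm_truncScale (N : ℕ) (r : ℝ) (z : ℂ) :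
    ‖truncScale N r z‖ = (√N)⁻¹ * (Metric.closedBall 0 r).indicator norm z := by
  rw [truncScale, norm_mul, norm_inv, Complex.norm_real, Real.norm_of_nonneg (Real.sqrt_nonneg _),
    norm_indicator_eq_indicator_norm]
  rfl

theorem norm_truncScale_le (N : ℕ) (r : ℝ) (z : ℂ) : ‖truncScale N r z‖ ≤ (√N)⁻¹ * |r| := by
  rw [norm_truncScale]
  gcongr
  exact Set.indicator_le' (fun z hz => (mem_closedBall_zero_iff.1 hz).trans (le_abs_self r))
    (fun _ _ => abs_nonneg r) z

theorem norm_truncScale_le_level (N : ℕ) {δ : ℝ} (hδ : 0 ≤ δ) (z : ℂ) :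
    ‖truncScale N (δ * √N) z‖ ≤ δ := by
  refine (norm_truncScale_le N _ z).trans ?_
  rw [abs_of_nonneg (by positivity), mul_left_comm]
  exact mul_le_of_le_one_right hδ inv_mul_le_one

theorem norm_truncScale_sq (N : ℕ) (r : ℝ) (z : ℂ) :
    ‖truncScale N r z‖ ^ 2 = (N : ℝ)⁻¹ * (Metric.closedBall 0 r).indicator (‖·‖ ^ 2) z := by
  rw [norm_truncScale, mul_pow, inv_pow, Real.sq_sqrt (Nat.cast_nonneg N)]
  by_cases hz : z ∈ Metric.closedBall 0 r <;> simp [hz]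

theorem integrable_norm_truncScale_pow [IsFiniteMeasure μ] (N : ℕ) (r : ℝ) (n : ℕ) :
    Integrable (fun z => ‖truncScale N r z‖ ^ n) μ := by
  refine Integrable.of_bound ((measurable_truncScale N r).norm.pow_const n).aestronglyMeasurable
    (((√N)⁻¹ * |r|) ^ n) (ae_of_all _ fun z => ?_)
  simp only [norm_pow, norm_norm]
  exact pow_le_pow_left₀ (norm_nonneg _) (norm_truncScale_le N r z) n

theorem integral_norm_truncScale_sq_le (h_sq : ∫ z, ‖z‖ ^ 2 ∂μ = 1) (N : ℕ) (r : ℝ) :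
    ∫ z, ‖truncScale N r z‖ ^ 2 ∂μ ≤ (N : ℝ)⁻¹ := by
  simp only [norm_truncScale_sq, integral_const_mul]
  refine mul_le_of_le_one_right (by positivity) ?_
  rw [← h_sq]
  exact integral_mono_of_nonneg
    (ae_of_all _ fun z => Set.indicator_nonneg (fun _ _ => by positivity) z)
    (integrable_of_integral_eq_one h_sq)
    (ae_of_all _ fun z => Set.indicator_le_self' (fun _ _ => by positivity) z)

theorem integral_norm_truncScale_pow_le [IsFiniteMeasure μ] (h_sq : ∫ z, ‖z‖ ^ 2 ∂μ = 1) (N : ℕ)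
    {δ : ℝ} (hδ : 0 ≤ δ) (hδ_one : δ ≤ 1) {n : ℕ} (hn : 3 ≤ n) :
    ∫ z, ‖truncScale N (δ * √N) z‖ ^ n ∂μ ≤ (N : ℝ)⁻¹ * δ := by
  have h_pow (z : ℂ) : ‖truncScale N (δ * √N) z‖ ^ n ≤ ‖truncScale N (δ * √N) z‖ ^ 2 * δ := by
    have h_le := norm_truncScale_le_level N hδ z
    calc ‖truncScale N (δ * √N) z‖ ^ n ≤ ‖truncScale N (δ * √N) z‖ ^ 3 :=
          pow_le_pow_of_le_one (norm_nonneg _) (h_le.trans hδ_one) hn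
      _ ≤ ‖truncScale N (δ * √N) z‖ ^ 2 * δ := by
          rw [pow_succ]
          gcongr
  calc ∫ z, ‖truncScale N (δ * √N) z‖ ^ n ∂μ
      ≤ ∫ z, ‖truncScale N (δ * √N) z‖ ^ 2 * δ ∂μ :=
        integral_mono (integrable_norm_truncScale_pow N _ n)
          ((integrable_norm_truncScale_pow N _ 2).mul_const δ) h_pow
    _ = (∫ z, ‖truncScale N (δ * √N) z‖ ^ 2 ∂μ) * δ := integral_mul_const _ _
    _ ≤ (N : ℝ)⁻¹ * δ := by
        gcongr
        exact integral_norm_truncScale_sq_le h_sq N _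

theorem norm_integral_closedBall_le (h_int : Integrable id μ) (h_mean : ∫ z, z ∂μ = 0)
    (h_four : Integrable (fun z : ℂ => ‖z‖ ^ 4) μ) {r : ℝ} (hr : 0 < r) :
    ‖∫ z in Metric.closedBall 0 r, z ∂μ‖ ≤ fourthTail μ r / r ^ 3 := by
  have h_compl : (Metric.closedBall (0 : ℂ) r)ᶜ = {z | r < ‖z‖} := by
    ext z
    simp
  have h_split : ∫ z in Metric.closedBall 0 r, z ∂μ = -∫ z in {z | r < ‖z‖}, z ∂μ := by
    rw [eq_neg_iff_add_eq_zero, ← h_compl, ← h_mean]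
    exact integral_add_compl measurableSet_closedBall h_int
  rw [h_split, norm_neg, le_div_iff₀' (by positivity)]
  calc r ^ 3 * ‖∫ z in {z | r < ‖z‖}, z ∂μ‖ ≤ r ^ 3 * ∫ z in {z | r < ‖z‖}, ‖z‖ ^ 1 ∂μ := by
        gcongr
        simpa only [pow_one] using norm_integral_le_integral_norm _
    _ ≤ fourthTail μ r := pow_mul_setIntegral_norm_pow_le_fourthTail h_four hr.le rfl

theorem norm_integral_truncScale_le (h_int : Integrable id μ) (h_mean : ∫ z, z ∂μ = 0)
    (h_four : Integrable (fun z : ℂ => ‖z‖ ^ 4) μ) {N : ℕ} (hN : 0 < N) {δ : ℝ} (hδ : 0 < δ)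
    (h_tail : fourthTail μ (δ * √N) ≤ δ ^ 4) :
    ‖∫ z, truncScale N (δ * √N) z ∂μ‖ ≤ (N : ℝ)⁻¹ * δ := by
  have hN_one : (1 : ℝ) ≤ N := by exact_mod_cast hN
  calc ‖∫ z, truncScale N (δ * √N) z ∂μ‖
      = (√N)⁻¹ * ‖∫ z in Metric.closedBall 0 (δ * √N), z ∂μ‖ := by
        simp only [truncScale]
        rw [integral_const_mul, integral_indicator measurableSet_closedBall, norm_mul, norm_inv,
          Complex.norm_real, Real.norm_of_nonneg (Real.sqrt_nonneg _)]
        rfl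
    _ ≤ (√N)⁻¹ * (δ ^ 4 / (δ * √N) ^ 3) := by
        gcongr
        refine (norm_integral_closedBall_le h_int h_mean h_four (by positivity)).trans ?_
        gcongr
    _ = ((√N ^ 2)⁻¹ * (√N ^ 2)⁻¹) * δ := by field_simp
    _ = ((N : ℝ)⁻¹ * (N : ℝ)⁻¹) * δ := by rw [Real.sq_sqrt N.cast_nonneg]
    _ ≤ (N : ℝ)⁻¹ * δ := by
        gcongr
        exact mul_le_of_le_one_right (by positivity) (inv_le_one_of_one_le₀ hN_one)

theorem norm_mixedMoment_le (y : ℂ → ℂ) (a b : ℕ) :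
    ‖mixedMoment μ y a b‖ ≤ ∫ z, ‖y z‖ ^ (a + b) ∂μ := by
  refine (norm_integral_le_integral_norm _).trans_eq ?_
  simp only [norm_mul, norm_pow, norm_star, pow_add]

theorem norm_mixedMoment_eq_of_add_eq_one (y : ℂ → ℂ) {a b : ℕ} (h : a + b = 1) :
    ‖mixedMoment μ y a b‖ = ‖∫ z, y z ∂μ‖ := by
  obtain ⟨rfl, rfl⟩ | ⟨rfl, rfl⟩ := Nat.add_eq_one_iff.1 h
  · simp only [mixedMoment, pow_zero, pow_one, one_mul, ← starRingEnd_apply, integral_conj,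
      RCLike.norm_conj]
  · simp only [mixedMoment, pow_zero, pow_one, mul_one]

theorem hasSmallMixedMoments_truncScale [IsProbabilityMeasure μ] (h_mean : ∫ z, z ∂μ = 0)
    (h_sq : ∫ z, ‖z‖ ^ 2 ∂μ = 1) (h_four : Integrable (fun z : ℂ => ‖z‖ ^ 4) μ) {N : ℕ}
    (hN : 0 < N) {δ : ℝ} (hδ : 0 < δ) (hδ_one : δ ≤ 1)
    (h_tail : fourthTail μ (δ * √N) ≤ δ ^ 4) :
    HasSmallMixedMoments (mixedMoment μ (truncScale N (δ * √N))) (N : ℝ)⁻¹ δ := by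
  have h_int : Integrable id μ := ((memLp_two_iff_integrable_sq_norm
    measurable_id.aestronglyMeasurable).2 (integrable_of_integral_eq_one h_sq)).integrable
      one_le_two
  have h_ne_two (a b : ℕ) (h₀ : a + b ≠ 0) (h₂ : a + b ≠ 2) :
      ‖mixedMoment μ (truncScale N (δ * √N)) a b‖ ≤ (N : ℝ)⁻¹ * δ := by
    obtain h₁ | h₃ : a + b = 1 ∨ 3 ≤ a + b := by omega
    · rw [norm_mixedMoment_eq_of_add_eq_one _ h₁]
      exact norm_integral_truncScale_le h_int h_mean h_four hN hδ h_tail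
    · exact (norm_mixedMoment_le _ a b).trans
        (integral_norm_truncScale_pow_le h_sq N hδ.le hδ_one h₃)
  refine ⟨by simp [mixedMoment], fun a b h₀ => ?_, h_ne_two⟩
  by_cases h₂ : a + b = 2
  · refine (norm_mixedMoment_le _ a b).trans ?_
    rw [h₂]
    exact integral_norm_truncScale_sq_le h_sq N _
  · exact (h_ne_two a b h₀ h₂).trans (mul_le_of_le_one_right (by positivity) hδ_one)

theorem mixedMoment_one_one (y : ℂ → ℂ) :
    mixedMoment μ y 1 1 = ((∫ z, ‖y z‖ ^ 2 ∂μ : ℝ) : ℂ) := by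
  rw [mixedMoment, ← integral_complex_ofReal]
  refine integral_congr_ae (ae_of_all _ fun z => ?_)
  simp only [pow_one, Complex.ofReal_pow]
  exact Complex.mul_conj' (y z)

theorem tendsto_mul_mixedMoment_truncScale (h_sq : ∫ z, ‖z‖ ^ 2 ∂μ = 1) {r : ℕ → ℝ}
    (hr : Tendsto r atTop atTop) :
    Tendsto (fun N : ℕ => (N : ℂ) * mixedMoment μ (truncScale N (r N)) 1 1) atTop (𝓝 1) := by
  have h_int := integrable_of_integral_eq_one h_sq
  have h_lim : Tendsto (fun N => ∫ z, (Metric.closedBall 0 (r N)).indicator (‖·‖ ^ 2) z ∂μ) atTop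
      (𝓝 (∫ z, ‖z‖ ^ 2 ∂μ)) := by
    refine tendsto_integral_of_dominated_convergence (fun z => ‖z‖ ^ 2)
      (fun N => (h_int.indicator measurableSet_closedBall).aestronglyMeasurable) h_int
      (fun N => ae_of_all _ fun z => ?_) (ae_of_all _ fun z => ?_)
    · exact (norm_indicator_le_norm_self _ z).trans_eq (by simp)
    · refine tendsto_const_nhds.congr' ?_
      filter_upwards [hr.eventually_ge_atTop ‖z‖] with N hN
      rw [Set.indicator_of_mem (mem_closedBall_zero_iff.2 hN)]
  rw [h_sq] at h_lim
  refine ((Complex.continuous_ofReal.tendsto 1).comp h_lim).congr' ?_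
  filter_upwards [eventually_ne_atTop 0] with N hN
  rw [mixedMoment_one_one]
  simp only [norm_truncScale_sq, integral_const_mul, Function.comp_apply]
  push_cast
  rw [mul_inv_cancel_left₀ (Nat.cast_ne_zero.2 hN)]

theorem exists_truncation_radius [IsProbabilityMeasure μ] (h_mean : ∫ z, z ∂μ = 0)
    (h_sq : ∫ z, ‖z‖ ^ 2 ∂μ = 1) (h_four : Integrable (fun z : ℂ => ‖z‖ ^ 4) μ) :
    ∃ r η : ℕ → ℝ, Tendsto r atTop atTop ∧ Tendsto η atTop (𝓝 0) ∧
      (∀ᶠ N : ℕ in atTop,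
        HasSmallMixedMoments (mixedMoment μ (truncScale N (r N))) (N : ℝ)⁻¹ (η N)) ∧
      Tendsto (fun N : ℕ => (N : ℝ) ^ 2 * μ.real {z | r N < ‖z‖}) atTop (𝓝 0) := by
  obtain ⟨δ, hδ_zero, h_top, h_tail⟩ := exists_truncation_level h_four
  have h_pos : ∀ᶠ N : ℕ in atTop, 0 < δ N := by
    filter_upwards [h_top.eventually_gt_atTop 0] with N hN
    exact pos_of_mul_pos_left hN (Real.sqrt_nonneg _)
  refine ⟨fun N => δ N * √N, δ, h_top, hδ_zero, ?_, ?_⟩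
  · filter_upwards [eventually_gt_atTop 0, h_pos, hδ_zero.eventually_le_const zero_lt_one,
      h_tail.eventually_le_const zero_lt_one] with N hN hδ hδ_one hδ_tail
    exact hasSmallMixedMoments_truncScale h_mean h_sq h_four hN hδ hδ_one
      ((div_le_one₀ (by positivity)).1 hδ_tail)
  · refine squeeze_zero' (Eventually.of_forall fun N => by positivity) ?_ h_tail
    filter_upwards [h_pos] with N hδ
    have h_sqrt : √(N : ℝ) ^ 4 = (N : ℝ) ^ 2 := by
      rw [show (4 : ℕ) = 2 * 2 by norm_num, pow_mul, Real.sq_sqrt (Nat.cast_nonneg N)]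
    have h_markov := pow_mul_setIntegral_norm_pow_le_fourthTail h_four
      (mul_nonneg hδ.le (Real.sqrt_nonneg N)) (add_zero 4)
    simp only [pow_zero, setIntegral_const, smul_eq_mul, mul_one, mul_pow, h_sqrt] at h_markov
    rwa [le_div_iff₀' (by positivity), ← mul_assoc]

end Truncation

section FussCatalanRecursion

theorem fussCatalan_mul_factorial (m p : ℕ) :
    fussCatalan m p * ((m * p + 1).factorial * p.factorial) = (m * p + p).factorial := by
  rw [← Nat.add_choose_mul_factorial_mul_factorial (m * p) p, fussCatalan, Nat.factorial_succ]
  have : (m : ℝ) * p + 1 ≠ 0 := by positivity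
  push_cast
  field_simp

theorem cast_factorial_add (a n : ℕ) :
    ((a + n).factorial : ℝ) = a.factorial * ∏ j ∈ Finset.range n, ((a : ℝ) + 1 + j) := by
  rw [← Nat.factorial_mul_ascFactorial, Nat.ascFactorial_eq_prod_range]
  push_cast
  rfl

theorem fussCatalan_zero (m : ℕ) : fussCatalan m 0 = 1 := by
  simp [fussCatalan]

theorem fussCatalan_succ_mul_prod (m p : ℕ) :
    fussCatalan m (p + 1) * ∏ j ∈ Finset.range m, ((m : ℝ) * p + j + 2) =
      fussCatalan m p * ((m + 1) * ∏ j ∈ Finset.range m, (((m : ℝ) + 1) * p + j + 1)) := by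
  have h_left : ((m * (p + 1) + 1).factorial : ℝ) =
      (m * p + 1).factorial * ∏ j ∈ Finset.range m, ((m : ℝ) * p + j + 2) := by
    rw [show m * (p + 1) + 1 = (m * p + 1) + m by ring, cast_factorial_add]
    push_cast
    exact congrArg _ (Finset.prod_congr rfl fun j _ => by ring)
  have h_right : ((m * (p + 1) + (p + 1)).factorial : ℝ) = (m * p + p).factorial *
      ((∏ j ∈ Finset.range m, (((m : ℝ) + 1) * p + j + 1)) * ((m + 1) * (p + 1))) := by
    rw [show m * (p + 1) + (p + 1) = (m * p + p) + (m + 1) by ring, cast_factorial_add,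
      Finset.prod_range_succ]
    push_cast
    congr 2
    · exact Finset.prod_congr rfl fun j _ => by ring
    · ring
  have h_succ := fussCatalan_mul_factorial m (p + 1)
  rw [h_left, h_right, ← fussCatalan_mul_factorial m p, Nat.factorial_succ p] at h_succ
  have h_ne : ((m * p + 1).factorial * (p.factorial * (p + 1)) : ℝ) ≠ 0 := by positivity
  apply mul_right_cancel₀ h_ne
  push_cast at h_succ
  linear_combination h_succ

end FussCatalanRecursion

section BetaMoments

variable {a b : ℝ}

theorem betaPDFReal_nonneg (ha : 0 < a) (hb : 0 < b) (y : ℝ) : 0 ≤ betaPDFReal a b y := by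
  by_cases h : 0 < y ∧ y < 1
  · exact (betaPDFReal_pos h.1 h.2 ha hb).le
  · rw [betaPDFReal, if_neg h]

theorem integral_betaPDFReal (ha : 0 < a) (hb : 0 < b) : ∫ y, betaPDFReal a b y = 1 := by
  rw [integral_eq_lintegral_of_nonneg_ae (ae_of_all _ (betaPDFReal_nonneg ha hb))
    (measurable_betaPDFReal a b).aestronglyMeasurable]
  exact (congrArg ENNReal.toReal (lintegral_betaPDF_eq_one ha hb)).trans ENNReal.toReal_one

theorem measurable_betaPDF (a b : ℝ) : Measurable (betaPDF a b) :=
  (measurable_betaPDFReal a b).ennreal_ofReal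

theorem betaPDFReal_mul_pow (ha : 0 < a) (hb : 0 < b) (p : ℕ) (y : ℝ) :
    betaPDFReal a b y * y ^ p = beta (a + p) b / beta a b * betaPDFReal (a + p) b y := by
  rw [betaPDFReal, betaPDFReal]
  split_ifs with hy
  · have h_pow : y ^ (a + p - 1) = y ^ (a - 1) * y ^ p := by
      rw [← Real.rpow_add_natCast hy.1.ne']
      ring_nf
    have h_beta := (beta_pos ha hb).ne'
    have h_beta_add := (beta_pos (show 0 < a + p by positivity) hb).ne'
    rw [h_pow]
    field_simp
  · simp

theorem integral_pow_betaMeasure (ha : 0 < a) (hb : 0 < b) (p : ℕ) :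
    ∫ y, y ^ p ∂betaMeasure a b = beta (a + p) b / beta a b := by
  rw [betaMeasure, integral_withDensity_eq_integral_toReal_smul (measurable_betaPDF a b)
    (ae_of_all _ fun _ => ENNReal.ofReal_lt_top)]
  simp only [betaPDF, ENNReal.toReal_ofReal (betaPDFReal_nonneg ha hb _), smul_eq_mul,
    betaPDFReal_mul_pow ha hb]
  rw [integral_const_mul, integral_betaPDFReal (by positivity) hb, mul_one]

theorem beta_add_one_left (ha : 0 < a) (hb : 0 < b) :
    beta (a + 1) b = beta a b * (a / (a + b)) := by
  have h_gamma : Real.Gamma (a + b) ≠ 0 := (Real.Gamma_pos_of_pos (by positivity)).ne'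
  have h_add : a + b ≠ 0 := by positivity
  rw [beta, beta, Real.Gamma_add_one ha.ne', show a + 1 + b = (a + b) + 1 by ring,
    Real.Gamma_add_one h_add]
  field_simp

theorem integral_pow_succ_betaMeasure (ha : 0 < a) (hb : 0 < b) (p : ℕ) :
    ∫ y, y ^ (p + 1) ∂betaMeasure a b =
      (∫ y, y ^ p ∂betaMeasure a b) * ((a + p) / (a + p + b)) := by
  rw [integral_pow_betaMeasure ha hb, integral_pow_betaMeasure ha hb]
  push_cast
  rw [← add_assoc, beta_add_one_left (by positivity) hb]
  ring

theorem ae_mem_Ioc_betaMeasure (a b : ℝ) : ∀ᵐ y ∂betaMeasure a b, y ∈ Set.Ioc (0 : ℝ) 1 := by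
  rw [betaMeasure, ae_withDensity_iff (measurable_betaPDF a b)]
  refine ae_of_all _ fun y hy => ⟨?_, ?_⟩
  · by_contra h
    exact hy (betaPDF_eq_zero_of_nonpos (not_lt.1 h))
  · by_contra h
    exact hy (betaPDF_eq_zero_of_one_le (not_le.1 h).le)

theorem betaMeasure_singleton (a b t : ℝ) : betaMeasure a b {t} = 0 :=
  withDensity_absolutelyContinuous _ _ Real.volume_singleton

end BetaMoments

section BetaProducts

theorem integral_pow_mconv (μ ν : Measure ℝ) [SFinite μ] [SFinite ν] (p : ℕ) :
    ∫ s, s ^ p ∂(μ ∗ₘ ν) = (∫ s, s ^ p ∂μ) * ∫ s, s ^ p ∂ν := by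
  rw [Measure.mconv, integral_map measurable_mul.aemeasurable (by fun_prop)]
  simp only [mul_pow]
  exact integral_prod_mul (fun s : ℝ => s ^ p) fun s : ℝ => s ^ p

theorem ae_mem_Ioc_mconv {μ ν : Measure ℝ} [SFinite μ] [SFinite ν] {K L : ℝ}
    (hμ : ∀ᵐ s ∂μ, s ∈ Set.Ioc 0 K) (hν : ∀ᵐ s ∂ν, s ∈ Set.Ioc 0 L) :
    ∀ᵐ s ∂(μ ∗ₘ ν), s ∈ Set.Ioc 0 (K * L) := by
  refine (ae_map_iff measurable_mul.aemeasurable measurableSet_Ioc).2 ?_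
  filter_upwards [Measure.quasiMeasurePreserving_fst.ae hμ,
    Measure.quasiMeasurePreserving_snd.ae hν] with q hq₁ hq₂
  exact ⟨mul_pos hq₁.1 hq₂.1,
    mul_le_mul hq₁.2 hq₂.2 hq₂.1.le (hq₁.1.le.trans hq₁.2)⟩

theorem mconv_singleton_eq_zero {μ ν : Measure ℝ} [SFinite μ] [SFinite ν]
    (hμ : ∀ᵐ s ∂μ, s ≠ 0) (hν : ∀ t, ν {t} = 0) (t : ℝ) : (μ ∗ₘ ν) {t} = 0 := by
  have h_meas := measurable_mul (M := ℝ) (measurableSet_singleton t)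
  rw [Measure.mconv, Measure.map_apply measurable_mul (measurableSet_singleton t),
    Measure.measure_prod_null h_meas]
  filter_upwards [hμ] with s hs
  refine measure_mono_null (fun y (hy : s * y = t) => ?_) (hν (t / s))
  rw [Set.mem_singleton_iff, ← hy, mul_div_cancel_left₀ _ hs]

/-- The law of the product of the constant `K` and of `n` independent beta variables with
parameters `(a j, b j)`, `j < n`. -/
noncomputable def betaProd (K : ℝ) (a b : ℕ → ℝ) : ℕ → Measure ℝ
  | 0 => Measure.dirac K
  | n + 1 => betaProd K a b n ∗ₘ betaMeasure (a n) (b n)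

variable {K : ℝ} {a b : ℕ → ℝ}

theorem isProbabilityMeasure_betaProd (ha : ∀ n, 0 < a n) (hb : ∀ n, 0 < b n) (n : ℕ) :
    IsProbabilityMeasure (betaProd K a b n) := by
  induction n with
  | zero => rw [betaProd]; infer_instance
  | succ n ih =>
    have := isProbabilityMeasureBeta (ha n) (hb n)
    rw [betaProd]
    infer_instance

theorem ae_mem_Ioc_betaProd (hK : 0 < K) (ha : ∀ n, 0 < a n) (hb : ∀ n, 0 < b n) (n : ℕ) :
    ∀ᵐ s ∂betaProd K a b n, s ∈ Set.Ioc 0 K := by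
  induction n with
  | zero =>
    exact (ae_dirac_iff measurableSet_Ioc).2 (Set.right_mem_Ioc.2 hK)
  | succ n ih =>
    have := isProbabilityMeasureBeta (ha n) (hb n)
    have := isProbabilityMeasure_betaProd (K := K) ha hb n
    simpa only [betaProd, mul_one] using ae_mem_Ioc_mconv ih (ae_mem_Ioc_betaMeasure (a n) (b n))

theorem integral_pow_betaProd (ha : ∀ n, 0 < a n) (hb : ∀ n, 0 < b n) (n p : ℕ) :
    ∫ s, s ^ p ∂betaProd K a b n =
      K ^ p * ∏ j ∈ Finset.range n, ∫ y, y ^ p ∂betaMeasure (a j) (b j) := by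
  induction n with
  | zero => simp [betaProd]
  | succ n ih =>
    have := isProbabilityMeasureBeta (ha n) (hb n)
    have := isProbabilityMeasure_betaProd (K := K) ha hb n
    rw [betaProd, integral_pow_mconv, ih, Finset.prod_range_succ, mul_assoc]

theorem integral_pow_succ_betaProd (ha : ∀ n, 0 < a n) (hb : ∀ n, 0 < b n) (n p : ℕ) :
    ∫ s, s ^ (p + 1) ∂betaProd K a b n = (∫ s, s ^ p ∂betaProd K a b n) *
      (K * ∏ j ∈ Finset.range n, (a j + p) / (a j + p + b j)) := by
  rw [integral_pow_betaProd ha hb, integral_pow_betaProd ha hb]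
  simp only [integral_pow_succ_betaMeasure (ha _) (hb _), Finset.prod_mul_distrib]
  ring

theorem betaProd_succ_singleton (hK : 0 < K) (ha : ∀ n, 0 < a n) (hb : ∀ n, 0 < b n) (n : ℕ)
    (t : ℝ) : betaProd K a b (n + 1) {t} = 0 := by
  have := isProbabilityMeasureBeta (ha n) (hb n)
  have := isProbabilityMeasure_betaProd (K := K) ha hb n
  refine mconv_singleton_eq_zero ?_ (betaMeasure_singleton (a n) (b n)) t
  filter_upwards [ae_mem_Ioc_betaProd hK ha hb n] with s hs using hs.1.ne'

theorem integral_pow_betaProd_eq_fussCatalan {m : ℕ} (ha : ∀ n, 0 < a n) (hb : ∀ n, 0 < b n)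
    (h_ratio : ∀ p : ℕ, (K * ∏ j ∈ Finset.range m, (a j + p) / (a j + p + b j)) *
      ∏ j ∈ Finset.range m, ((m : ℝ) * p + j + 2) =
        (m + 1) * ∏ j ∈ Finset.range m, (((m : ℝ) + 1) * p + j + 1)) (p : ℕ) :
    ∫ s, s ^ p ∂betaProd K a b m = fussCatalan m p := by
  induction p with
  | zero =>
    have := isProbabilityMeasure_betaProd (K := K) ha hb m
    simp [fussCatalan_zero]
  | succ p ih =>
    have h_ne : ∏ j ∈ Finset.range m, ((m : ℝ) * p + j + 2) ≠ 0 :=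
      Finset.prod_ne_zero_iff.2 fun j _ => by positivity
    apply mul_right_cancel₀ h_ne
    rw [integral_pow_succ_betaProd ha hb, ih, fussCatalan_succ_mul_prod, mul_assoc, h_ratio]

theorem integrable_pow_of_abs_le {μ : Measure ℝ} [IsFiniteMeasure μ] {K : ℝ}
    (hμ : ∀ᵐ s ∂μ, |s| ≤ K) (p : ℕ) : Integrable (fun s : ℝ => s ^ p) μ := by
  refine Integrable.of_bound (by fun_prop) (K ^ p) ?_
  filter_upwards [hμ] with s hs
  rw [norm_pow, Real.norm_eq_abs]
  exact pow_le_pow_left₀ (abs_nonneg s) hs p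

theorem exists_isFussCatalanLaw {m : ℕ} (hm : 1 ≤ m) :
    ∃ (G : Measure ℝ) (K : ℝ), IsFussCatalanLaw m G ∧ (∀ᵐ s ∂G, |s| ≤ K) ∧ ∀ t, G {t} = 0 := by
  have hm_pos : (0 : ℝ) < m := by exact_mod_cast hm
  -- These parameters turn the ratios of beta moments into those of the Fuss–Catalan recursion.
  set K : ℝ := ((m : ℝ) + 1) * (((m : ℝ) + 1) / m) ^ m with hK
  set a : ℕ → ℝ := fun j => ((j : ℝ) + 1) / (m + 1) with ha
  set b : ℕ → ℝ := fun j => ((j : ℝ) + 2) / m - ((j : ℝ) + 1) / (m + 1) with hb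
  have hK_pos : 0 < K := by positivity
  have ha_pos (j : ℕ) : 0 < a j := by positivity
  have hb_pos (j : ℕ) : 0 < b j := by
    simp only [hb, sub_pos]
    gcongr <;> linarith
  have h_factor (p j : ℕ) : (a j + p) / (a j + p + b j) * ((m : ℝ) * p + j + 2) =
      m / (m + 1) * (((m : ℝ) + 1) * p + j + 1) := by
    have h_sum : a j + p + b j = ((m : ℝ) * p + j + 2) / m := by
      simp only [ha, hb]
      field_simp
      ring
    rw [h_sum]
    simp only [ha]
    field_simp
    ring
  have h_const : K * ((m : ℝ) / (m + 1)) ^ m = m + 1 := by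
    rw [hK, mul_assoc, ← mul_pow, div_mul_div_cancel₀ hm_pos.ne', div_self (by positivity),
      one_pow, mul_one]
  have h_supp : ∀ᵐ s ∂betaProd K a b m, |s| ≤ K := by
    filter_upwards [ae_mem_Ioc_betaProd hK_pos ha_pos hb_pos m] with s hs
    rw [abs_of_pos hs.1]
    exact hs.2
  have h_prob := isProbabilityMeasure_betaProd (K := K) ha_pos hb_pos m
  refine ⟨betaProd K a b m, K, ⟨h_prob, integrable_pow_of_abs_le h_supp, fun p => ?_⟩, h_supp, ?_⟩
  · refine integral_pow_betaProd_eq_fussCatalan ha_pos hb_pos (fun p => ?_) p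
    rw [mul_assoc, ← Finset.prod_mul_distrib, Finset.prod_congr rfl fun j _ => h_factor p j,
      Finset.prod_mul_distrib, Finset.prod_const, Finset.card_range, ← mul_assoc, h_const]
  · obtain ⟨n, rfl⟩ := Nat.exists_eq_add_of_le' hm
    exact betaProd_succ_singleton hK_pos ha_pos hb_pos n

end BetaProducts

section MethodOfMoments

open Polynomial

theorem integrable_eval {μ : Measure ℝ} (hμ : ∀ p : ℕ, Integrable (fun s : ℝ => s ^ p) μ)
    (Q : ℝ[X]) : Integrable (fun s => Q.eval s) μ := by
  simp only [eval_eq_sum_range]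
  exact integrable_finsetSum _ fun i _ => (hμ i).const_mul _

theorem integral_eval {μ : Measure ℝ} (hμ : ∀ p : ℕ, Integrable (fun s : ℝ => s ^ p) μ)
    (Q : ℝ[X]) :
    ∫ s, Q.eval s ∂μ = ∑ i ∈ Finset.range (Q.natDegree + 1), Q.coeff i * ∫ s, s ^ i ∂μ := by
  simp only [eval_eq_sum_range]
  rw [integral_finsetSum _ fun i _ => (hμ i).const_mul _]
  simp only [integral_const_mul]

theorem abs_eval_le (Q : ℝ[X]) {L : ℝ} (hL : 0 < L) {n : ℕ} (hn : Q.natDegree ≤ n) {s : ℝ}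
    (hs : L ≤ |s|) :
    |Q.eval s| ≤ (∑ i ∈ Finset.range (Q.natDegree + 1), |Q.coeff i| * L ^ i) * (|s| / L) ^ n := by
  have h_one_le : 1 ≤ |s| / L := (one_le_div hL).2 hs
  rw [eval_eq_sum_range, Finset.sum_mul]
  refine (Finset.abs_sum_le_sum_abs _ _).trans (Finset.sum_le_sum fun i hi => ?_)
  have hi_le : i ≤ n := (Finset.mem_range_succ_iff.1 hi).trans hn
  calc |Q.coeff i * s ^ i| = |Q.coeff i| * L ^ i * (|s| / L) ^ i := by
        rw [abs_mul, abs_pow, mul_assoc, ← mul_pow, mul_div_cancel₀ _ hL.ne']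
    _ ≤ |Q.coeff i| * L ^ i * (|s| / L) ^ n := by gcongr

theorem exists_polynomial_dominating (Q : ℝ[X]) {K L ε : ℝ} (hK : 0 ≤ K) (hKL : K < L)
    (hε : 0 < ε) :
    ∃ R : ℝ[X], (∀ s, 0 ≤ R.eval s) ∧ (∀ s, |s| ≤ K → R.eval s ≤ ε) ∧
      ∀ s, L ≤ |s| → |Q.eval s| ≤ R.eval s := by
  have hL : 0 < L := hK.trans_lt hKL
  set A := ∑ i ∈ Finset.range (Q.natDegree + 1), |Q.coeff i| * L ^ i
  have hA_nonneg : 0 ≤ A := Finset.sum_nonneg fun i _ => by positivity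
  have h_small : Tendsto (fun n : ℕ => A * (K / L) ^ (2 * n)) atTop (𝓝 0) := by
    have h_lt : (K / L) ^ 2 < 1 :=
      pow_lt_one₀ (by positivity) ((div_lt_one hL).2 hKL) two_ne_zero
    simpa only [pow_mul, mul_zero] using
      (tendsto_pow_atTop_nhds_zero_of_lt_one (by positivity) h_lt).const_mul A
  obtain ⟨n, hn_small, hn_degree⟩ :=
    ((h_small.eventually_le_const hε).and (eventually_ge_atTop Q.natDegree)).exists
  have h_eval (s : ℝ) : (C A * (C L⁻¹ * X) ^ (2 * n)).eval s = A * (|s| / L) ^ (2 * n) := by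
    rw [← abs_of_pos hL, ← abs_div, pow_mul |s / _|, sq_abs, ← pow_mul, div_eq_inv_mul,
      abs_of_pos hL]
    simp
  refine ⟨C A * (C L⁻¹ * X) ^ (2 * n), fun s => ?_, fun s hs => ?_, fun s hs => ?_⟩
  · rw [h_eval]
    exact mul_nonneg hA_nonneg (by positivity)
  · rw [h_eval]
    exact le_trans (by gcongr) hn_small
  · rw [h_eval]
    exact abs_eval_le Q hL (by omega) hs

theorem exists_polynomial_majorant {f : ℝ → ℝ} (hf : Continuous f) {c : ℝ} (hc : ∀ s, f s ≤ c)
    (K : ℝ) {ε : ℝ} (hε : 0 < ε) :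
    ∃ Q : ℝ[X], (∀ s, f s ≤ Q.eval s) ∧ ∀ s, |s| ≤ K → Q.eval s ≤ f s + ε := by
  set L := |K| + 1
  obtain ⟨p, hp⟩ := exists_polynomial_near_of_continuousOn (-L) L f hf.continuousOn (ε / 4)
    (by positivity)
  obtain ⟨R, hR_nonneg, hR_le, hR_ge⟩ := exists_polynomial_dominating (p + C (ε / 4) - C c)
    (abs_nonneg K) (lt_add_one |K|) (half_pos hε)
  have h_near (s : ℝ) (hs : |s| ≤ L) : -(ε / 4) < p.eval s - f s ∧ p.eval s - f s < ε / 4 :=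
    abs_lt.1 (hp s (abs_le.1 hs))
  refine ⟨p + C (ε / 4) + R, fun s => ?_, fun s hs => ?_⟩
  · rw [eval_add, eval_add, eval_C]
    rcases le_total |s| L with h_le | h_ge
    · linarith [(h_near s h_le).1, hR_nonneg s]
    · have h_dom := neg_le_of_abs_le (hR_ge s h_ge)
      rw [eval_sub, eval_add, eval_C, eval_C] at h_dom
      linarith [hc s]
  · have hs_le : |s| ≤ |K| := hs.trans (le_abs_self K)
    rw [eval_add, eval_add, eval_C]
    linarith [(h_near s (hs_le.trans (lt_add_one |K|).le)).2, hR_le s hs_le]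

theorem exists_polynomial_indicator_le {μ : Measure ℝ} [IsProbabilityMeasure μ] {K : ℝ}
    (hμ : ∀ᵐ s ∂μ, |s| ≤ K) {F : Set ℝ} (hF : IsClosed F) {ε : ℝ} (hε : 0 < ε) :
    ∃ Q : ℝ[X], (∀ s, F.indicator (fun _ => (1 : ℝ)) s ≤ Q.eval s) ∧
      ∫ s, Q.eval s ∂μ ≤ μ.real F + ε := by
  have h_tendsto := tendsto_integral_thickenedIndicator_of_isClosed μ hF
    (fun n : ℕ => Nat.one_div_pos_of_nat) tendsto_one_div_add_atTop_nhds_zero_nat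
  obtain ⟨n, hn⟩ := (h_tendsto.eventually_le_const (lt_add_of_pos_right _ (half_pos hε))).exists
  set f : ℝ → ℝ := fun s => (thickenedIndicator (Nat.one_div_pos_of_nat (n := n)) F s : ℝ)
  have hf : Integrable f μ := integrable_thickenedIndicator F _
  obtain ⟨Q, hQ_ge, hQ_le⟩ := exists_polynomial_majorant (f := f) (by fun_prop)
    (fun s => thickenedIndicator_le_one _ F s) K (half_pos hε)
  refine ⟨Q, fun s => le_trans ?_ (hQ_ge s), ?_⟩
  · refine Set.indicator_le' (fun s hs => ?_) (fun s _ => NNReal.coe_nonneg _) s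
    simp only [thickenedIndicator_one _ F hs, NNReal.coe_one, le_refl]
  · calc ∫ s, Q.eval s ∂μ ≤ ∫ s, (f s + ε / 2) ∂μ :=
          integral_mono_ae (integrable_eval (integrable_pow_of_abs_le hμ) Q)
            (hf.add (integrable_const _)) (hμ.mono fun s hs => hQ_le s hs)
      _ = ∫ s, f s ∂μ + ε / 2 := by
          rw [integral_add hf (integrable_const _), integral_const, probReal_univ, one_smul]
      _ ≤ μ.real F + ε := by linarith

theorem exists_polynomial_le_indicator {μ : Measure ℝ} [IsProbabilityMeasure μ] {K : ℝ}
    (hμ : ∀ᵐ s ∂μ, |s| ≤ K) {U : Set ℝ} (hU : IsOpen U) {ε : ℝ} (hε : 0 < ε) :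
    ∃ Q : ℝ[X], (∀ s, Q.eval s ≤ U.indicator (fun _ => (1 : ℝ)) s) ∧
      μ.real U - ε ≤ ∫ s, Q.eval s ∂μ := by
  obtain ⟨Q, hQ, hQ_int⟩ := exists_polynomial_indicator_le hμ hU.isClosed_compl hε
  refine ⟨1 - Q, fun s => ?_, ?_⟩
  · have h_compl := congrFun (Set.indicator_compl_add_self U fun _ : ℝ => (1 : ℝ)) s
    rw [Pi.add_apply] at h_compl
    rw [eval_sub, eval_one]
    linarith [hQ s]
  · simp only [eval_sub, eval_one]
    rw [integral_sub (integrable_const _) (integrable_eval (integrable_pow_of_abs_le hμ) Q),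
      integral_const, probReal_univ, one_smul]
    rw [probReal_compl_eq_one_sub hU.measurableSet] at hQ_int
    linarith

theorem measureReal_Iio_eq_cdf {μ : Measure ℝ} [IsProbabilityMeasure μ] {t : ℝ}
    (ht : μ {t} = 0) : μ.real (Set.Iio t) = cdf μ t := by
  rw [cdf_eq_real, Measure.real, Measure.real, measure_congr (Iio_ae_eq_Iic' ht)]

/-- The functionals `E i` play the role of integration against measures whose distribution function
at `t` is `F i`. -/
theorem tendsto_cdf_of_tendsto_polynomial {ι : Type*} {l : Filter ι} {μ : Measure ℝ}
    [IsProbabilityMeasure μ] {K : ℝ} (hμ : ∀ᵐ s ∂μ, |s| ≤ K) {t : ℝ} (ht : μ {t} = 0)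
    {E : ι → ℝ[X] → ℝ} {F : ι → ℝ}
    (h_upper : ∀ i (Q : ℝ[X]),
      (∀ s, (Set.Iic t).indicator (fun _ => (1 : ℝ)) s ≤ Q.eval s) → F i ≤ E i Q)
    (h_lower : ∀ i (Q : ℝ[X]),
      (∀ s, Q.eval s ≤ (Set.Iic t).indicator (fun _ => (1 : ℝ)) s) → E i Q ≤ F i)
    (h_tendsto : ∀ Q : ℝ[X], Tendsto (fun i => E i Q) l (𝓝 (∫ s, Q.eval s ∂μ))) :
    Tendsto F l (𝓝 (cdf μ t)) := by
  refine tendsto_order.2 ⟨fun a ha => ?_, fun a ha => ?_⟩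
  · obtain ⟨Q, hQ, hQ_int⟩ := exists_polynomial_le_indicator hμ (isOpen_Iio (a := t))
      (half_pos (sub_pos.2 ha))
    rw [measureReal_Iio_eq_cdf ht] at hQ_int
    have hQ_Iic (s : ℝ) : Q.eval s ≤ (Set.Iic t).indicator (fun _ => (1 : ℝ)) s :=
      (hQ s).trans (Set.indicator_le_indicator_of_subset Set.Iio_subset_Iic_self
        (fun _ => zero_le_one) s)
    filter_upwards [(h_tendsto Q).eventually_const_lt (show a < _ by linarith)] with i hi
    exact hi.trans_le (h_lower i Q hQ_Iic)
  · obtain ⟨Q, hQ, hQ_int⟩ := exists_polynomial_indicator_le hμ (isClosed_Iic (a := t))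
      (half_pos (sub_pos.2 ha))
    rw [← cdf_eq_real] at hQ_int
    filter_upwards [(h_tendsto Q).eventually_lt_const (show _ < a by linarith)] with i hi
    exact (h_upper i Q hQ).trans_lt hi

theorem eq_of_integral_pow_eq {μ ν : Measure ℝ} [IsProbabilityMeasure μ] [IsProbabilityMeasure ν]
    {K : ℝ} (hμ : ∀ᵐ s ∂μ, |s| ≤ K) (hμ_atom : ∀ t, μ {t} = 0)
    (hν : ∀ p : ℕ, Integrable (fun s : ℝ => s ^ p) ν)
    (h_moments : ∀ p : ℕ, ∫ s, s ^ p ∂ν = ∫ s, s ^ p ∂μ) : ν = μ := by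
  have h_eval (Q : ℝ[X]) : ∫ s, Q.eval s ∂ν = ∫ s, Q.eval s ∂μ := by
    simp only [integral_eval hν, integral_eval (integrable_pow_of_abs_le hμ), h_moments]
  refine Measure.eq_of_cdf ν μ (StieltjesFunction.ext fun t => ?_)
  have h_cdf : ∫ s, (Set.Iic t).indicator (fun _ => (1 : ℝ)) s ∂ν = cdf ν t := by
    rw [integral_indicator_const _ measurableSet_Iic, smul_eq_mul, mul_one, cdf_eq_real]
  have h_int : Integrable ((Set.Iic t).indicator fun _ => (1 : ℝ)) ν :=
    (integrable_const 1).indicator measurableSet_Iic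
  refine tendsto_nhds_unique tendsto_const_nhds <|
    tendsto_cdf_of_tendsto_polynomial (l := (atTop : Filter ℕ)) hμ (hμ_atom t)
      (E := fun _ Q => ∫ s, Q.eval s ∂ν) (fun _ Q hQ => ?_) (fun _ Q hQ => ?_)
      (fun Q => tendsto_const_nhds.congr fun _ => (h_eval Q).symm)
  · exact h_cdf.symm.trans_le (integral_mono h_int (integrable_eval hν Q) hQ)
  · exact (integral_mono (integrable_eval hν Q) h_int hQ).trans_eq h_cdf

theorem exists_polynomial_tendsto_indicator {F : Set ℝ} (hF : IsClosed F) :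
    ∃ Q : ℕ → ℝ[X], ∀ s, Tendsto (fun n => (Q n).eval s) atTop
      (𝓝 (F.indicator (fun _ => (1 : ℝ)) s)) := by
  set f : ℕ → ℝ → ℝ := fun n s => hF.apprSeq n s
  have hf_tendsto (s : ℝ) :
      Tendsto (fun n => f n s) atTop (𝓝 (F.indicator (fun _ => (1 : ℝ)) s)) := by
    have h_nnreal := tendsto_pi_nhds.1 (HasOuterApproxClosed.tendsto_apprSeq hF) s
    simpa only [NNReal.coe_indicator, NNReal.coe_one] using NNReal.tendsto_coe.2 h_nnreal
  choose Q hQ using fun n : ℕ => exists_polynomial_near_of_continuousOn (-(n : ℝ)) n (f n)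
    (by fun_prop) (1 / ((n : ℝ) + 1)) Nat.one_div_pos_of_nat
  refine ⟨Q, fun s => (hf_tendsto s).congr_dist (squeeze_zero' (.of_forall fun _ => dist_nonneg) ?_
    tendsto_one_div_add_atTop_nhds_zero_nat)⟩
  filter_upwards [tendsto_natCast_atTop_atTop.eventually_ge_atTop |s|] with n hn
  rw [dist_comm, Real.dist_eq]
  exact (hQ n s (abs_le.1 hn)).le

end MethodOfMoments

section SpectralStatistics

open Polynomial

variable {N : ℕ}

theorem trace_pow_eq_sum_eigenvalues_pow {A : Matrix (Fin N) (Fin N) ℂ} (hA : A.IsHermitian)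
    (p : ℕ) : (A ^ p).trace = ((∑ k, hA.eigenvalues k ^ p : ℝ) : ℂ) := by
  conv_lhs => rw [hA.spectral_theorem, ← map_pow, Unitary.conjStarAlgAut_apply,
    Matrix.trace_mul_comm, ← mul_assoc]
  simp [Matrix.diagonal_pow, Matrix.trace_diagonal]

/-- The integral of the polynomial `Q` against the empirical measure of the eigenvalues of
`X^m (X^*)^m`. -/
noncomputable def empiricalMean (m : ℕ) (X : Matrix (Fin N) (Fin N) ℂ) (Q : ℝ[X]) : ℝ :=
  (N : ℝ)⁻¹ * ∑ k, Q.eval ((powerGram_isHermitian m X).eigenvalues k)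

theorem empiricalMean_eq_sum_trace (m : ℕ) (X : Matrix (Fin N) (Fin N) ℂ) (Q : ℝ[X]) :
    empiricalMean m X Q = ∑ i ∈ Finset.range (Q.natDegree + 1),
      Q.coeff i * ((N : ℂ)⁻¹ * (powerGram m X ^ i).trace).re := by
  have h_re (i : ℕ) : ((N : ℂ)⁻¹ * (powerGram m X ^ i).trace).re =
      (N : ℝ)⁻¹ * ∑ k, (powerGram_isHermitian m X).eigenvalues k ^ i := by
    rw [trace_pow_eq_sum_eigenvalues_pow (powerGram_isHermitian m X), ← Complex.ofReal_natCast,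
      ← Complex.ofReal_inv, ← Complex.ofReal_mul, Complex.ofReal_re]
  simp only [empiricalMean, h_re, eval_eq_sum_range]
  rw [Finset.sum_comm, Finset.mul_sum]
  refine Finset.sum_congr rfl fun i _ => ?_
  rw [← Finset.mul_sum, mul_left_comm]

theorem continuous_trace_powerGram_pow (N m p : ℕ) :
    Continuous fun X : Fin N → Fin N → ℂ => (powerGram m (Matrix.of X) ^ p).trace := by
  unfold powerGram
  fun_prop

theorem continuous_empiricalMean (N m : ℕ) (Q : ℝ[X]) :
    Continuous fun X : Fin N → Fin N → ℂ => empiricalMean m (Matrix.of X) Q := by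
  have h_trace := continuous_trace_powerGram_pow N m
  simp only [empiricalMean_eq_sum_trace]
  fun_prop

theorem measurable_empiricalDF (N m : ℕ) (t : ℝ) :
    Measurable fun X : Fin N → Fin N → ℂ => empiricalDF m (Matrix.of X) t := by
  obtain ⟨Q, hQ⟩ := exists_polynomial_tendsto_indicator (isClosed_Iic (a := t))
  exact measurable_of_tendsto_metrizable
    (fun n => (continuous_empiricalMean N m (Q n)).measurable)
    (tendsto_pi_nhds.2 fun X => (tendsto_finsetSum _ fun k _ => hQ _).const_mul _)

variable (m : ℕ) (X : Matrix (Fin N) (Fin N) ℂ) {t : ℝ}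

theorem empiricalDF_le_empiricalMean {Q : ℝ[X]}
    (hQ : ∀ s, (Set.Iic t).indicator (fun _ => (1 : ℝ)) s ≤ Q.eval s) :
    empiricalDF m X t ≤ empiricalMean m X Q :=
  mul_le_mul_of_nonneg_left (Finset.sum_le_sum fun _ _ => hQ _) (by positivity)

theorem empiricalMean_le_empiricalDF {Q : ℝ[X]}
    (hQ : ∀ s, Q.eval s ≤ (Set.Iic t).indicator (fun _ => (1 : ℝ)) s) :
    empiricalMean m X Q ≤ empiricalDF m X t :=
  mul_le_mul_of_nonneg_left (Finset.sum_le_sum fun _ _ => hQ _) (by positivity)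

theorem empiricalDF_mem_Icc (t : ℝ) : empiricalDF m X t ∈ Set.Icc (0 : ℝ) 1 := by
  have h_mem (s : ℝ) : (Set.Iic t).indicator (fun _ => (1 : ℝ)) s ∈ Set.Icc (0 : ℝ) 1 :=
    ⟨Set.indicator_nonneg (fun _ _ => zero_le_one) s,
      Set.indicator_le_self' (fun _ _ => zero_le_one) s⟩
  refine ⟨mul_nonneg (by positivity) (Finset.sum_nonneg fun k _ => (h_mem _).1), ?_⟩
  calc empiricalDF m X t ≤ (N : ℝ)⁻¹ * ∑ _k : Fin N, 1 :=
        mul_le_mul_of_nonneg_left (Finset.sum_le_sum fun k _ => (h_mem _).2) (by positivity)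
    _ = (N : ℝ)⁻¹ * N := by simp
    _ ≤ 1 := inv_mul_le_one

end SpectralStatistics

section MeanSpectralDistribution

open Polynomial

variable {Ω : Type*} [MeasurableSpace Ω] {P : Measure Ω}

theorem integrable_comp_of_norm_le [IsFiniteMeasure P] {E F : Type*} [NormedAddCommGroup E]
    [ProperSpace E] [MeasurableSpace E] [BorelSpace E] [NormedAddCommGroup F] {φ : E → F}
    (hφ : Continuous φ) {X : Ω → E} (hX : AEMeasurable X P) {C : ℝ} (hC : ∀ ω, ‖X ω‖ ≤ C) :
    Integrable (fun ω => φ (X ω)) P := by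
  obtain ⟨D, hD⟩ := (isCompact_closedBall (0 : E) C).exists_bound_of_continuousOn hφ.continuousOn
  exact Integrable.of_bound (hφ.comp_aestronglyMeasurable hX.aestronglyMeasurable) D
    (ae_of_all _ fun ω => hD _ (mem_closedBall_zero_iff.2 (hC ω)))

theorem integrable_empiricalDF [IsFiniteMeasure P] {N : ℕ} (m : ℕ) (t : ℝ)
    {X : Ω → Fin N → Fin N → ℂ} (hX : AEMeasurable X P) :
    Integrable (fun ω => empiricalDF m (Matrix.of (X ω)) t) P := by
  refine Integrable.of_bound ((measurable_empiricalDF N m t).comp_aemeasurable hX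
    |>.aestronglyMeasurable) 1 (ae_of_all _ fun ω => ?_)
  have h_mem := empiricalDF_mem_Icc m (Matrix.of (X ω)) t
  exact (Real.norm_of_nonneg h_mem.1).trans_le h_mem.2

theorem integral_empiricalMean [IsFiniteMeasure P] {N : ℕ} (m : ℕ) {X : Ω → Fin N → Fin N → ℂ}
    (hX : AEMeasurable X P) {C : ℝ} (hC : ∀ ω, ‖X ω‖ ≤ C) (Q : ℝ[X]) :
    ∫ ω, empiricalMean m (Matrix.of (X ω)) Q ∂P = ∑ i ∈ Finset.range (Q.natDegree + 1),
      Q.coeff i * ((N : ℂ)⁻¹ * ∫ ω, (powerGram m (Matrix.of (X ω)) ^ i).trace ∂P).re := by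
  have h_int (i : ℕ) : Integrable
      (fun ω => (N : ℂ)⁻¹ * (powerGram m (Matrix.of (X ω)) ^ i).trace) P :=
    (integrable_comp_of_norm_le (continuous_trace_powerGram_pow N m i) hX hC).const_mul _
  have h_re (i : ℕ) : Integrable
      (fun ω => ((N : ℂ)⁻¹ * (powerGram m (Matrix.of (X ω)) ^ i).trace).re) P := (h_int i).re
  simp only [empiricalMean_eq_sum_trace]
  rw [integral_finsetSum _ fun i _ => (h_re i).const_mul _]
  refine Finset.sum_congr rfl fun i _ => ?_
  rw [integral_const_mul, ← integral_const_mul (N : ℂ)⁻¹]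
  exact congrArg _ (integral_re (h_int i))

theorem tendsto_integral_empiricalDF [IsFiniteMeasure P] {m : ℕ}
    {X : (N : ℕ) → Ω → Fin N → Fin N → ℂ} (hX : ∀ N, AEMeasurable (X N) P) {C : ℕ → ℝ}
    (hC : ∀ N ω, ‖X N ω‖ ≤ C N) {G : Measure ℝ} [IsProbabilityMeasure G] {K : ℝ}
    (hG : ∀ᵐ s ∂G, |s| ≤ K) {t : ℝ} (ht : G {t} = 0)
    (h_moments : ∀ p : ℕ, Tendsto
      (fun N : ℕ => (N : ℂ)⁻¹ * ∫ ω, (powerGram m (Matrix.of (X N ω)) ^ p).trace ∂P) atTop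
      (𝓝 ((∫ s, s ^ p ∂G : ℝ) : ℂ))) :
    Tendsto (fun N : ℕ => ∫ ω, empiricalDF m (Matrix.of (X N ω)) t ∂P) atTop (𝓝 (cdf G t)) := by
  have h_mean (N : ℕ) (Q : ℝ[X]) :
      Integrable (fun ω => empiricalMean m (Matrix.of (X N ω)) Q) P :=
    integrable_comp_of_norm_le (continuous_empiricalMean N m Q) (hX N) (hC N)
  have h_df (N : ℕ) := integrable_empiricalDF m t (hX N)
  refine tendsto_cdf_of_tendsto_polynomial hG ht
    (E := fun N Q => ∫ ω, empiricalMean m (Matrix.of (X N ω)) Q ∂P)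
    (fun N Q hQ => integral_mono (h_df N) (h_mean N Q)
      fun ω => empiricalDF_le_empiricalMean m _ hQ)
    (fun N Q hQ => integral_mono (h_mean N Q) (h_df N)
      fun ω => empiricalMean_le_empiricalDF m _ hQ) fun Q => ?_
  simp only [fun N => integral_empiricalMean m (hX N) (hC N) Q,
    integral_eval (integrable_pow_of_abs_le hG)]
  exact tendsto_finsetSum _ fun i _ =>
    ((Complex.continuous_re.tendsto _).comp (h_moments i)).const_mul _

theorem abs_integral_empiricalDF_sub_le [IsFiniteMeasure P] {N : ℕ} (m : ℕ) (t : ℝ)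
    {X Y : Ω → Fin N → Fin N → ℂ} (hX : AEMeasurable X P) (hY : AEMeasurable Y P) :
    |∫ ω, empiricalDF m (Matrix.of (X ω)) t ∂P - ∫ ω, empiricalDF m (Matrix.of (Y ω)) t ∂P| ≤
      P.real {ω | X ω ≠ Y ω} := by
  have h_meas : NullMeasurableSet {ω | X ω ≠ Y ω} P := (nullMeasurableSet_eq_fun hX hY).compl
  rw [← integral_sub (integrable_empiricalDF m t hX) (integrable_empiricalDF m t hY),
    ← Real.norm_eq_abs, ← mul_one (P.real _), ← smul_eq_mul, ← setIntegral_const,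
    ← integral_indicator₀ h_meas]
  refine norm_integral_le_of_norm_le ((integrable_const 1).indicator₀ h_meas)
    (ae_of_all _ fun ω => ?_)
  by_cases hω : X ω = Y ω
  · rw [hω, sub_self, norm_zero]
    exact Set.indicator_nonneg (fun _ _ => zero_le_one) ω
  · have h_mem : ω ∈ {ω | X ω ≠ Y ω} := hω
    rw [Set.indicator_of_mem h_mem]
    exact Real.dist_le_of_mem_Icc_01 (empiricalDF_mem_Icc m _ t) (empiricalDF_mem_Icc m _ t)

end MeanSpectralDistribution

section TruncatedModel

variable {Ω : Type*} [MeasurableSpace Ω] {P : Measure Ω} {μ : Measure ℂ}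

theorem abs_integral_empiricalDF_sub_truncScale_le [IsFiniteMeasure P] {N : ℕ} (m : ℕ) (t r : ℝ)
    {x : Fin N → Fin N → Ω → ℂ} (hx : ∀ i j, IdentDistrib (x i j) id P μ) :
    |∫ ω, empiricalDF m (scaledMatrix fun i j => x i j ω) t ∂P -
        ∫ ω, empiricalDF m (Matrix.of fun i j => truncScale N r (x i j ω)) t ∂P| ≤
      (N : ℝ) ^ 2 * μ.real {z | r < ‖z‖} := by
  have hx_meas (i j : Fin N) : AEMeasurable (x i j) P := (hx i j).aemeasurable_fst
  have h_scaled : AEMeasurable (fun ω i j => ((√N : ℝ) : ℂ)⁻¹ * x i j ω) P := by fun_prop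
  have h_trunc : AEMeasurable (fun ω i j => truncScale N r (x i j ω)) P :=
    aemeasurable_pi_lambda _ fun i => aemeasurable_pi_lambda _ fun j =>
      (measurable_truncScale N r).comp_aemeasurable (hx_meas i j)
  have h_tail (e : Fin N × Fin N) : P.real {ω | r < ‖x e.1 e.2 ω‖} = μ.real {z | r < ‖z‖} :=
    congrArg ENNReal.toReal ((hx e.1 e.2).measure_mem_eq (measurableSet_lt_norm r))
  refine (abs_integral_empiricalDF_sub_le m t h_scaled h_trunc).trans ?_
  calc _ ≤ P.real (⋃ e : Fin N × Fin N, {ω | r < ‖x e.1 e.2 ω‖}) := by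
        refine measureReal_mono fun ω hω => ?_
        contrapose! hω
        simp only [Set.mem_iUnion, Set.mem_ofPred_eq, not_exists, not_lt] at hω
        exact not_not.2 (funext₂ fun i j => (truncScale_of_norm_le (hω (i, j))).symm)
    _ ≤ ∑ e : Fin N × Fin N, P.real {ω | r < ‖x e.1 e.2 ω‖} := measureReal_iUnion_fintype_le _
    _ = (N : ℝ) ^ 2 * μ.real {z | r < ‖z‖} := by
        simp only [h_tail, Finset.sum_const, Finset.card_univ, Fintype.card_prod,
          Fintype.card_fin, nsmul_eq_mul]
        push_cast
        ring

variable {m : ℕ} {x : (N : ℕ) → Fin N → Fin N → Ω → ℂ} {G : Measure ℝ}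
  {K t : ℝ}

theorem tendsto_integral_empiricalDF_truncScale [IsFiniteMeasure P] (h_sq : ∫ z, ‖z‖ ^ 2 ∂μ = 1)
    (hx : ∀ N i j, IdentDistrib (x N i j) id P μ)
    (h_indep : ∀ N : ℕ, iIndepFun (fun e : Fin N × Fin N => x N e.1 e.2) P) {r η : ℕ → ℝ}
    (hr : Tendsto r atTop atTop) (hη : Tendsto η atTop (𝓝 0))
    (h_moments : ∀ᶠ N : ℕ in atTop,
      HasSmallMixedMoments (mixedMoment μ (truncScale N (r N))) (N : ℝ)⁻¹ (η N))
    (hG : IsFussCatalanLaw m G) (hG_bdd : ∀ᵐ s ∂G, |s| ≤ K) (ht : G {t} = 0) :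
    Tendsto (fun N : ℕ =>
        ∫ ω, empiricalDF m (Matrix.of fun i j => truncScale N (r N) (x N i j ω)) t ∂P)
      atTop (𝓝 (cdf G t)) := by
  have hG_prob := hG.isProbabilityMeasure
  set C : ℕ → ℝ := fun N => (√N)⁻¹ * |r N|
  have hC (N : ℕ) (z : ℂ) : ‖truncScale N (r N) z‖ ≤ C N := norm_truncScale_le N (r N) z
  have hC_nonneg (N : ℕ) : 0 ≤ C N := by positivity
  have h_ident (N : ℕ) (e : Fin N × Fin N) :
      IdentDistrib (fun ω => truncScale N (r N) (x N e.1 e.2 ω)) (truncScale N (r N)) P μ :=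
    (hx N e.1 e.2).comp (measurable_truncScale N (r N))
  refine tendsto_integral_empiricalDF (X := fun N ω i j => truncScale N (r N) (x N i j ω)) (C := C)
    (fun N => aemeasurable_pi_lambda _ fun i => aemeasurable_pi_lambda _ fun j =>
      (h_ident N (i, j)).aemeasurable_fst)
    (fun N ω => (pi_norm_le_iff_of_nonneg (hC_nonneg N)).2 fun i =>
      (pi_norm_le_iff_of_nonneg (hC_nonneg N)).2 fun j => hC N _) hG_bdd ht fun p => ?_
  rw [hG.moment_eq p]
  exact tendsto_integral_trace_powerGram h_ident
    (fun N => (h_indep N).comp _ fun _ => measurable_truncScale N (r N))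
    (fun N e ω => hC N _) hη h_moments (tendsto_mul_mixedMoment_truncScale h_sq hr) m p

theorem tendsto_integral_empiricalDF_scaledMatrix [IsFiniteMeasure P] [IsProbabilityMeasure μ]
    (h_mean : ∫ z, z ∂μ = 0) (h_sq : ∫ z, ‖z‖ ^ 2 ∂μ = 1)
    (h_four : Integrable (fun z : ℂ => ‖z‖ ^ 4) μ)
    (hx : ∀ N i j, IdentDistrib (x N i j) id P μ)
    (h_indep : ∀ N : ℕ, iIndepFun (fun e : Fin N × Fin N => x N e.1 e.2) P)
    (hG : IsFussCatalanLaw m G) (hG_bdd : ∀ᵐ s ∂G, |s| ≤ K) (ht : G {t} = 0) :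
    Tendsto (fun N : ℕ => ∫ ω, empiricalDF m (scaledMatrix fun i j => x N i j ω) t ∂P)
      atTop (𝓝 (cdf G t)) := by
  obtain ⟨r, η, hr, hη, h_moments, h_tail⟩ := exists_truncation_radius h_mean h_sq h_four
  refine (tendsto_integral_empiricalDF_truncScale h_sq hx h_indep hr hη h_moments hG hG_bdd
    ht).congr_dist (squeeze_zero (fun _ => dist_nonneg) (fun N => ?_) h_tail)
  rw [dist_comm, Real.dist_eq]
  exact abs_integral_empiricalDF_sub_truncScale_le m t (r N) (hx N)

end TruncatedModel

theorem corollary1 {Ω₀ Ω : Type*} [MeasurableSpace Ω₀] [MeasurableSpace Ω]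
    (P₀ : Measure Ω₀) [IsProbabilityMeasure P₀] (P : Measure Ω) [IsProbabilityMeasure P]
    (m : ℕ) (hm : 1 ≤ m)
    (x : Ω₀ → ℂ) (hx : AEMeasurable x P₀)
    (hx_mean : ∫ ω, x ω ∂P₀ = 0)
    (hx_var : ∫ ω, ‖x ω‖ ^ 2 ∂P₀ = 1)
    (hx_four : Integrable (fun ω => ‖x ω‖ ^ 4) P₀)
    (xs : (N : ℕ) → Fin N → Fin N → Ω → ℂ)
    (h_copies : ∀ (N : ℕ) (i j : Fin N), IdentDistrib (xs N i j) x P P₀)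
    (h_indep : ∀ N : ℕ, iIndepFun (fun ij : Fin N × Fin N => xs N ij.1 ij.2) P) :
    ∃ G : Measure ℝ, IsFussCatalanLaw m G ∧
      (∀ ν : Measure ℝ, IsFussCatalanLaw m ν → ν = G) ∧
      ∀ t : ℝ,
        (∀ N : ℕ,
          Integrable (fun ω => empiricalDF m (scaledMatrix fun i j => xs N i j ω) t) P) ∧
        Tendsto
          (fun N : ℕ => ∫ ω, empiricalDF m (scaledMatrix fun i j => xs N i j ω) t ∂P)
          atTop (𝓝 (cdf G t)) := by
  obtain ⟨G, K, hG, hG_bdd, hG_atom⟩ := exists_isFussCatalanLaw hm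
  have hG_prob := hG.isProbabilityMeasure
  have hμ_prob := Measure.isProbabilityMeasure_map hx
  have hxs_meas (N : ℕ) (i j : Fin N) : AEMeasurable (xs N i j) P :=
    (h_copies N i j).aemeasurable_fst
  refine ⟨G, hG, fun ν hν => ?_, fun t => ⟨fun N => ?_, ?_⟩⟩
  · have hν_prob := hν.isProbabilityMeasure
    exact eq_of_integral_pow_eq hG_bdd hG_atom hν.integrable_pow
      fun p => (hν.moment_eq p).trans (hG.moment_eq p).symm
  · exact integrable_empiricalDF (X := fun ω i j => ((√N : ℝ) : ℂ)⁻¹ * xs N i j ω) m t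
      (by fun_prop)
  · refine tendsto_integral_empiricalDF_scaledMatrix (μ := P₀.map x) ?_ ?_ ?_
      (fun N i j => ⟨hxs_meas N i j, aemeasurable_id, ?_⟩) h_indep hG hG_bdd (hG_atom t)
    · rwa [integral_map hx (by fun_prop)]
    · rwa [integral_map hx (by fun_prop)]
    · rwa [integrable_map_measure (by fun_prop) hx]
    · rw [Measure.map_id, (h_copies N i j).map_eq]
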